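/- Let $n\ge 2$ and let $\mathbb T^n=\mathbb R^n/\mathbb Z^n$ be the flat $n$-torus with its Riemannian distance and volume. Then there are no homeomorphism $f$ of $\mathbb T^n$ and continuous map $h:\mathbb T^n\to\mathbb T^n$ such that all of the following hold. (1) ($f$ is of Denjoy type, with semiconjugacy $h$.) $f$ is isotopic to the identity (in particular orientation preserving) and is not topologically conjugate to a translation; $h$ is homotopic to the identity; the set $V_h=\{p\in\mathbb T^n:\ \# h^{-1}(p)>1\}$ is non-empty and countable; and there is a minimal translation $R$ of $\mathbb T^n$ (every orbit $\{R^k(x):k\in\mathbb Z\}$ is dense) with $h\circ f=R\circ h$. (2) $f$ is quasiconformal: a lift of $f$ to $\mathbb R^n$ belongs to the Sobolev space $W^{1,n}_{\rm loc}$, and for some $K>0$ its formal differential satisfies $\sup\{\|Df(x)v\|^n:\ \|v\|\le 1\}\le K\det Df(x)$ for almost every $x$. (3) The minimal set $\Lambda=\mathbb T^n\setminus\bigcup_{p\in V_h}\big(h^{-1}(p)\big)^{o}$ has measure zero, where $X^o$ denotes the interior of $X$. (4) The wandering domains, i.e. the non-empty sets among $D_p=\big(h^{-1}(p)\big)^{o}$,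 $p\in V_h$, have bounded geometry: there is $C\ge 1$ such that for each of them there are $x\in D_p$ and $0<r\le R$ with $B(x,r)\subseteq D_p\subseteq B(x,R)$ and $R/r\le C$, where $B(x,r)$ is the ball of radius $r$ centered at $x$. -/

import Mathlib

open MeasureTheory Set
open scoped ContDiff

noncomputable section

namespace DenjoyTori

/-- Euclidean `n`-space. -/
abbrev Euc (n : ℕ) := EuclideanSpace ℝ (Fin n)

/-- The `n`-torus `(ℝ / ℤ)ⁿ`, with its product topology, group structure and product measure
(the Riemannian volume of the flat torus). -/
abbrev Torus (n : ℕ) := UnitAddTorus (Fin n)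

/-- The covering projection `ℝⁿ → 𝕋ⁿ`. -/
def proj (n : ℕ) (x : Euc n) : Torus n := fun i => ((x i : ℝ) : UnitAddCircle)

/-- The flat distance on `𝕋ⁿ`, induced by the Euclidean metric of `ℝⁿ` (the distance which the
product type carries in Mathlib is the maximum distance instead). On each circle factor `‖·‖` is
the distance to the nearest integer. -/
def flatDist {n : ℕ} (p q : Torus n) : ℝ := Real.sqrt (∑ i, ‖p i - q i‖ ^ 2)

/-- The open ball of the flat torus. -/
def flatBall {n : ℕ} (p : Torus n) (r : ℝ) : Set (Torus n) := {q | flatDist q p < r}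

/-! ### Quasiconformal homeomorphisms of the torus -/

/-- `G x`, a linear map for each `x`, is the matrix of first distributional partial derivatives of
the continuous map `F`. -/
def HasWeakDifferential {n : ℕ} (F : Euc n → Euc n) (G : Euc n → Euc n →L[ℝ] Euc n) : Prop :=
  ∀ φ : Euc n → ℝ, ContDiff ℝ ∞ φ → HasCompactSupport φ → ∀ v : Euc n,
    ∫ x, (fderiv ℝ φ x v) • F x = - ∫ x, φ x • G x v

/-- `G` is locally in `Lⁿ`. -/
def LocallyLn {n : ℕ} (G : Euc n → Euc n →L[ℝ] Euc n) : Prop :=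
  ∀ A : Set (Euc n), IsCompact A → MemLp G (n : ENNReal) (volume.restrict A)

/-- A homeomorphism of the flat torus is quasiconformal if, read in the flat charts, that is, for a
lift `F` to the universal cover, it is in the Sobolev class `W^{1,n}_loc` and its formal
differential `G` satisfies `sup_{‖v‖ ≤ 1} ‖G x v‖ⁿ ≤ K det (G x)` almost everywhere. -/
def IsQuasiconformal {n : ℕ} (f : Torus n ≃ₜ Torus n) : Prop :=
  ∃ F : Euc n → Euc n, Continuous F ∧ (∀ x, proj n (F x) = f (proj n x)) ∧
    ∃ G : Euc n → Euc n →L[ℝ] Euc n, HasWeakDifferential F G ∧ LocallyLn G ∧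
      ∃ K : ℝ, 0 < K ∧ ∀ᵐ x, ∀ v : Euc n, ‖v‖ ≤ 1 → ‖G x v‖ ^ n ≤ K * (G x).det

/-! ### Denjoy type homeomorphisms -/

/-- `f` is isotopic to the identity: it is joined to it by a path of homeomorphisms. -/
def IsIsotopicToId {n : ℕ} (f : Torus n ≃ₜ Torus n) : Prop :=
  ContinuousMap.HomotopicWith (ContinuousMap.id (Torus n)) (f : C(Torus n, Torus n))
    (fun g => IsHomeomorph g)

/-- The translation by `a` is minimal: every orbit is dense. -/
def IsMinimalTranslation {n : ℕ} (a : Torus n) : Prop :=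
  ∀ x : Torus n, Dense (range fun k : ℤ => x + k • a)

/-- `f` is topologically conjugate to a translation of the torus. -/
def IsConjugateToTranslation {n : ℕ} (f : Torus n ≃ₜ Torus n) : Prop :=
  ∃ (b : Torus n) (g : Torus n ≃ₜ Torus n), ∀ x, g (f x) = g x + b

/-- The set of non-trivial values of `h`: points with more than one preimage. -/
def nontrivialValues {n : ℕ} (h : C(Torus n, Torus n)) : Set (Torus n) :=
  {p | (h ⁻¹' {p}).Nontrivial}

/-- `f` has Denjoy type, and `h` is a semiconjugacy to a minimal translation which witnesses it. -/
structure IsDenjoyType {n : ℕ} (f : Torus n ≃ₜ Torus n) (h : C(Torus n, Torus n)) : Prop where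
  isotopic : IsIsotopicToId f
  homotopic : h.Homotopic (ContinuousMap.id (Torus n))
  nonempty : (nontrivialValues h).Nonempty
  countable : (nontrivialValues h).Countable
  semiconj : ∃ a : Torus n, IsMinimalTranslation a ∧ ∀ x, h (f x) = h x + a
  not_conj : ¬ IsConjugateToTranslation f

/-- The minimal set: the complement of the interiors of the non-trivial fibres. -/
def minimalSet {n : ℕ} (h : C(Torus n, Torus n)) : Set (Torus n) :=
  (⋃ p ∈ nontrivialValues h, interior (h ⁻¹' {p}))ᶜ

/-- The wandering domains: the non-empty interiors of the non-trivial fibres. -/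
def wanderingDomains {n : ℕ} (h : C(Torus n, Torus n)) : Set (Set (Torus n)) :=
  {D | D.Nonempty ∧ ∃ p ∈ nontrivialValues h, D = interior (h ⁻¹' {p})}

/-- A collection of subsets of the flat torus has bounded geometry: with one constant `C`, each
contains a ball and lies in a concentric ball of at most `C` times the radius. -/
def HasBoundedGeometry {n : ℕ} (𝒟 : Set (Set (Torus n))) : Prop :=
  ∃ C : ℝ, 1 ≤ C ∧ ∀ D ∈ 𝒟, ∃ p ∈ D, ∃ r R : ℝ, 0 < r ∧ r ≤ R ∧
    flatBall p r ⊆ D ∧ D ⊆ flatBall p R ∧ R / r ≤ C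

end DenjoyTori

end

/-!
The proof compares the wandering domains with the images under iterates of `f` of the straight
lines parallel to the first axis. Write `D p` for the interior of `h ⁻¹' {p}`, let `a` be the
translation to which `f` is semiconjugate, and choose radii `ρ p` with `D p` contained in a ball of
radius `ρ p`. By bounded geometry `ρ p ^ n` is at most a constant multiple of the volume of `D p`,
so `∑ ρ p ^ n` is finite.

Fix `k`, and let `u` be the first coordinate of a lift of `fᵏ`. On almost every line parallel to the
first axis, `u` makes one full turn of the circle. It maps the part of the line inside `D p` into an
arc of length `2 ρ (p + k a)`, since `fᵏ` maps `D p` into `D (p + k a)`, and the part inside the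
null minimal set contributes nothing provided that `u` is a Sobolev function. The lines that meet
`D p` have measure at most `(2 ρ p) ^ (n - 1)`. Integration over all lines gives the *crossing
inequality* (`IsSobolevLimit.one_le_tsum`)

`1 ≤ ∑ 2 ρ (p + k a) (2 ρ p) ^ (n - 1)`, for every `k`.

The points `p + k a` are pairwise distinct because the translation is minimal. As `ρ` is in `ℓⁿ` and
`n ≥ 2`, its correlations with its translates along the orbit tend to zero
(`exists_tsum_mul_pow_lt_one`), and the crossing inequality fails for some `k`.

That `u` is a Sobolev function for every `k` is where quasiconformality enters. The notion used,
`IsSobolevLimit`, is that of a uniform limit of `C¹` functions whose differentials converge in `Lⁿ`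
of a fundamental cube; the crossing inequality is proved for `C¹` functions by a change of variable
on each line and survives this limit. The class is stable under composition with a lift `F` of `f`
(`IsSobolevLimit.comp`), since `‖A ∘ DF‖ⁿ ≤ K ‖A‖ⁿ det DF`, and the Jacobian is absorbed by the
degree formula `∫ Ψ(F) det DF = ∫ Ψ` over the cube (`lintegral_det_mul_comp`). For smooth maps the
degree formula is proved for the characters `Ψ` of the torus. Along the segment `id + t φ` from the
identity both sides are entire in `t` and, by change of variable, agree for small `t`. Mollification
carries it over to Sobolev maps, and uniqueness of Fourier coefficients to all Borel `Ψ`. So neither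
the change of variable formula for Sobolev homeomorphisms nor their absolute continuity on lines is
needed.
-/

noncomputable section

namespace DenjoyTori

/-! ### The torus, its fundamental cube, and lifts -/

/-- The integer vector `m`, as an element of `ℝⁿ`. -/
def intVec {n : ℕ} (m : Fin n → ℤ) : Euc n := WithLp.toLp 2 fun i => (m i : ℝ)

@[simp] lemma intVec_apply {n : ℕ} (m : Fin n → ℤ) (i : Fin n) : intVec m i = (m i : ℝ) := rfl

/-- The half-open unit cube, a fundamental domain of `ℤⁿ` acting on `ℝⁿ`. -/
def cube (n : ℕ) : Set (Euc n) := {x | ∀ i, x i ∈ Ico (0 : ℝ) 1}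

/-- A self-map of `ℝⁿ` which is the identity plus a `ℤⁿ`-periodic map. -/
def IsEquivariant {n : ℕ} (F : Euc n → Euc n) : Prop :=
  ∀ (x : Euc n) (m : Fin n → ℤ), F (x + intVec m) = F x + intVec m

/-- A `ℤⁿ`-periodic map on `ℝⁿ`. -/
def IsPeriodic {n : ℕ} {X : Type*} (F : Euc n → X) : Prop :=
  ∀ (x : Euc n) (m : Fin n → ℤ), F (x + intVec m) = F x

lemma continuous_proj (n : ℕ) : Continuous (proj n) := by
  unfold proj
  exact continuous_pi fun i =>
    (AddCircle.continuous_mk' (1 : ℝ)).comp (EuclideanSpace.proj i : Euc n →L[ℝ] ℝ).continuous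

lemma proj_add {n : ℕ} (x y : Euc n) : proj n (x + y) = proj n x + proj n y := by
  ext i; simp [proj]

lemma proj_intVec {n : ℕ} (m : Fin n → ℤ) : proj n (intVec m) = 0 := by
  ext i
  simp only [proj, intVec_apply, Pi.zero_apply]
  exact (AddCircle.coe_eq_zero_iff (1 : ℝ)).2 ⟨m i, by simp⟩

lemma isPeriodic_proj (n : ℕ) : IsPeriodic (proj n) := fun x m => by
  rw [proj_add, proj_intVec, add_zero]

lemma measurable_cube (n : ℕ) : MeasurableSet (cube n) := by
  have : cube n = ⋂ i, (fun x : Euc n => x i) ⁻¹' Ico (0 : ℝ) 1 := by ext; simp [cube]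
  rw [this]
  exact MeasurableSet.iInter fun i =>
    (EuclideanSpace.proj i : Euc n →L[ℝ] ℝ).continuous.measurable measurableSet_Ico

lemma fundamentalDomain_eq_cube (n : ℕ) :
    ZSpan.fundamentalDomain (EuclideanSpace.basisFun (Fin n) ℝ).toBasis = cube n := by
  ext x; simp [ZSpan.mem_fundamentalDomain, cube]

/-- The integer vectors are the lattice spanned by the standard basis. -/
lemma mem_span_basisFun_iff {n : ℕ} (x : Euc n) :
    x ∈ Submodule.span ℤ (Set.range (EuclideanSpace.basisFun (Fin n) ℝ).toBasis) ↔
      ∃ m : Fin n → ℤ, x = intVec m := by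
  rw [Module.Basis.mem_span_iff_repr_mem]
  simp only [OrthonormalBasis.coe_toBasis_repr_apply, EuclideanSpace.basisFun_repr]
  constructor
  · intro h
    choose m hm using h
    exact ⟨m, by ext i; simpa using (hm i).symm⟩
  · rintro ⟨m, rfl⟩ i
    exact ⟨m i, by simp⟩

lemma bounded_cube (n : ℕ) : Bornology.IsBounded (cube n) := by
  rw [← fundamentalDomain_eq_cube]
  exact ZSpan.fundamentalDomain_isBounded _

/-- The projection of the unit cube to the torus preserves volume. -/
lemma measurePreserving_proj (n : ℕ) :
    MeasurePreserving (proj n) (volume.restrict (cube n)) volume := by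
  have h1 : MeasurePreserving (fun (x : Fin n → ℝ) (i : Fin n) => ((x i : ℝ) : UnitAddCircle))
      (volume.restrict (univ.pi fun _ => Ico (0 : ℝ) 1)) volume := by
    have h := measurePreserving_pi (fun _ : Fin n => volume.restrict (Ioc (0 : ℝ) (0 + 1)))
      (fun _ : Fin n => (volume : Measure UnitAddCircle))
      (fun _ : Fin n => UnitAddCircle.measurePreserving_mk 0)
    have hμ : (volume : Measure (Fin n → ℝ)).restrict (univ.pi fun _ => Ico (0 : ℝ) 1) =
        Measure.pi (fun _ : Fin n => volume.restrict (Ioc (0 : ℝ) (0 + 1))) := by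
      rw [volume_pi, Measure.restrict_pi_pi]
      congr 1; ext1 i
      rw [zero_add]
      exact Measure.restrict_congr_set Ico_ae_eq_Ioc
    rw [hμ]
    exact h
  have h2 := (PiLp.volume_preserving_ofLp (Fin n)).restrict_preimage
    (s := univ.pi fun _ => Ico (0 : ℝ) 1) (MeasurableSet.univ_pi fun _ => measurableSet_Ico)
  have h3 := h1.comp h2
  have hc : cube n = WithLp.ofLp ⁻¹' univ.pi fun _ => Ico (0 : ℝ) 1 := by
    ext x; simp [cube]
  rw [hc]
  exact h3

lemma volume_cube (n : ℕ) : volume (cube n) = 1 := by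
  have := (measurePreserving_proj n).measure_preimage MeasurableSet.univ.nullMeasurableSet
  simpa [volume_pi, Measure.pi_univ] using this

instance isProbabilityMeasure_restrict_cube (n : ℕ) :
    IsProbabilityMeasure (volume.restrict (cube n)) :=
  ⟨by simp [volume_cube]⟩

/-- Every point of `ℝⁿ` has an integer translate in the unit cube. -/
lemma exists_add_intVec_mem_cube {n : ℕ} (x : Euc n) : ∃ m : Fin n → ℤ, x + intVec m ∈ cube n :=
  ⟨fun i => -⌊x i⌋, fun i => by
    have h1 := Int.floor_le (x i)
    have h2 := Int.lt_floor_add_one (x i)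
    simp only [PiLp.add_apply, intVec_apply, Int.cast_neg, mem_Ico]
    constructor <;> linarith⟩

/-- A continuous periodic function is bounded. -/
lemma IsPeriodic.exists_bound {n : ℕ} {X : Type*} [SeminormedAddCommGroup X] {F : Euc n → X}
    (hF : IsPeriodic F) (hc : Continuous F) : ∃ M : ℝ, 0 ≤ M ∧ ∀ x, ‖F x‖ ≤ M := by
  obtain ⟨M, hM⟩ := (bounded_cube n).isCompact_closure.exists_bound_of_continuousOn
    hc.continuousOn
  have hM' : ∀ x, ‖F x‖ ≤ M := fun x => by
    obtain ⟨m, hm⟩ := exists_add_intVec_mem_cube x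
    rw [← hF x m]
    exact hM _ (subset_closure hm)
  exact ⟨M, (norm_nonneg _).trans (hM' 0), hM'⟩

/-- A map of the torus homotopic to the identity is the identity plus the projection of a
continuous displacement defined on the torus itself. -/
lemma exists_lift_of_homotopic {n : ℕ} {g : C(Torus n, Torus n)}
    (hg : (ContinuousMap.id (Torus n)).Homotopic g) :
    ∃ δ : Torus n → Euc n, Continuous δ ∧ ∀ p, g p = p + proj n (δ p) := by
  obtain ⟨H⟩ := hg
  have key : ∀ i : Fin n, ∃ d : C(Torus n, ℝ), ∀ p, g p i = p i + ((d p : ℝ) : UnitAddCircle) := by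
    intro i
    let K : C(unitInterval × Torus n, UnitAddCircle) :=
      ⟨fun z => H z i - z.2 i, by fun_prop⟩
    have cov := AddCircle.isCoveringMap_coe (1 : ℝ)
    have h0 : ∀ a, K (0, a) = (((0 : C(Torus n, ℝ)) a : ℝ) : UnitAddCircle) := by
      intro a; simp [K]
    refine ⟨⟨fun p => cov.liftHomotopy K 0 h0 (1, p), by fun_prop⟩, fun p => ?_⟩
    have := congrFun (cov.liftHomotopy_lifts K 0 h0) (1, p)
    simp only [Function.comp_apply] at this
    simp only [ContinuousMap.coe_mk]
    rw [this]
    simp [K]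
  choose d hd using key
  refine ⟨fun p => WithLp.toLp 2 fun i => d i p, ?_, fun p => ?_⟩
  · exact (PiLp.continuous_toLp 2 _).comp (continuous_pi fun i => (d i).continuous)
  · ext i; simp [proj, hd]

/-- A continuous function on `ℝⁿ` whose values are integers is constant. -/
lemma eq_of_coe_eq_zero {n : ℕ} {u : Euc n → ℝ} (hu : Continuous u)
    (h : ∀ x, ((u x : ℝ) : UnitAddCircle) = 0) (x y : Euc n) : u x = u y := by
  have hd : IsDiscrete (Set.range ((↑) : ℤ → ℝ)) :=
    ⟨Int.isClosedEmbedding_coe_real.isEmbedding.toHomeomorph.symm.isEmbedding.discreteTopology⟩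
  refine isPreconnected_univ.constant_of_mapsTo hd hu.continuousOn ?_ (mem_univ x) (mem_univ y)
  intro z _
  obtain ⟨k, hk⟩ := (AddCircle.coe_eq_zero_iff (1 : ℝ)).1 (h z)
  exact ⟨k, by simpa using hk⟩

/-- Every continuous lift of a map homotopic to the identity is the identity plus a periodic map. -/
lemma isEquivariant_of_lift {n : ℕ} {g : C(Torus n, Torus n)}
    (hg : (ContinuousMap.id (Torus n)).Homotopic g) {F : Euc n → Euc n} (hF : Continuous F)
    (hlift : ∀ x, proj n (F x) = g (proj n x)) : IsEquivariant F := by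
  obtain ⟨δ, hδ, hgδ⟩ := exists_lift_of_homotopic hg
  intro x m
  ext i
  have hcont : Continuous fun x : Euc n => F x i - x i - δ (proj n x) i := by
    have := continuous_proj n
    have h1 : ∀ {v : Euc n → Euc n}, Continuous v → Continuous fun x => v x i := fun hv =>
      (EuclideanSpace.proj i : Euc n →L[ℝ] ℝ).continuous.comp hv
    exact ((h1 hF).sub (h1 continuous_id)).sub (h1 (hδ.comp this))
  have := eq_of_coe_eq_zero hcont (fun x => ?_) (x + intVec m) x
  · simp only [PiLp.add_apply, isPeriodic_proj n x m, intVec_apply] at this ⊢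
    linarith
  · have h := congrFun ((hlift x).trans (hgδ _)) i
    simp only [proj, Pi.add_apply] at h
    simp only [AddCircle.coe_sub, h]
    abel

/-! ### The degree formula for smooth maps -/

lemma IsPeriodic.fderiv {n : ℕ} {X : Type*} [NormedAddCommGroup X] [NormedSpace ℝ X]
    {φ : Euc n → X} (hφ : IsPeriodic φ) : IsPeriodic (fderiv ℝ φ) := fun x m => by
  rw [← fderiv_comp_add_right (f := φ) (intVec m)]
  congr 1
  exact funext fun y => hφ y m

lemma IsEquivariant.isPeriodic_sub {n : ℕ} {F : Euc n → Euc n} (hF : IsEquivariant F) :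
    IsPeriodic fun x => F x - x := fun x m => by
  simp [hF x m]

/-- A linear perturbation of the identity of norm at most `1 / 2` has positive determinant. -/
lemma det_one_add_pos {n : ℕ} {B : Euc n →L[ℝ] Euc n} (hB : ‖B‖ ≤ 1 / 2) :
    0 < (ContinuousLinearMap.id ℝ (Euc n) + B).det := by
  have hne : ∀ s ∈ Icc (0 : ℝ) 1, (ContinuousLinearMap.id ℝ (Euc n) + s • B).det ≠ 0 := by
    intro s hs h0
    obtain ⟨v, hv, hv0⟩ := (Submodule.ne_bot_iff _).1 (LinearMap.bot_lt_ker_of_det_eq_zero h0).ne'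
    have h1 : v + s • B v = 0 := by simpa using hv
    have h2 : ‖v‖ = ‖s • B v‖ := by
      rw [← norm_neg (s • B v), ← eq_neg_of_add_eq_zero_left h1]
    have h3 : ‖s • B v‖ ≤ 1 * (1 / 2 * ‖v‖) := by
      rw [norm_smul]
      gcongr
      · rw [Real.norm_eq_abs, abs_of_nonneg hs.1]; exact hs.2
      · exact B.le_of_opNorm_le hB v
    have h4 : 0 < ‖v‖ := norm_pos_iff.2 hv0
    linarith
  by_contra hcon
  have hcont : ContinuousOn (fun s : ℝ => (ContinuousLinearMap.id ℝ (Euc n) + s • B).det)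
      (Icc 0 1) :=
    (ContinuousLinearMap.continuous_det.comp (by fun_prop)).continuousOn
  have h0 : (ContinuousLinearMap.id ℝ (Euc n) + (0 : ℝ) • B).det = 1 := by
    simp [ContinuousLinearMap.det]
  have h1 : (ContinuousLinearMap.id ℝ (Euc n) + (1 : ℝ) • B).det ≤ 0 := by
    simpa using not_lt.1 hcon
  obtain ⟨s, hs, hs0⟩ := intermediate_value_Icc' (zero_le_one' ℝ) hcont
    (show (0 : ℝ) ∈ _ from ⟨h1, by simp only [h0]; norm_num⟩)
  exact hne s hs hs0

/-- Change of variables for an equivariant homeomorphism close to the identity. -/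
lemma integral_comp_mul_det_of_small {n : ℕ} {φ : Euc n → Euc n} (hφ : IsPeriodic φ)
    (hd : ContDiff ℝ 1 φ) (hsmall : ∀ x, ‖fderiv ℝ φ x‖ ≤ 1 / 2) {ψ : Euc n → ℂ}
    (hψ : IsPeriodic ψ) :
    ∫ x in cube n, ((ContinuousLinearMap.id ℝ (Euc n) + fderiv ℝ φ x).det : ℂ) * ψ (x + φ x) =
      ∫ x in cube n, ψ x := by
  set Φ : Euc n → Euc n := fun x => x + φ x with hΦ
  have hdiff : Differentiable ℝ φ := hd.differentiable one_ne_zero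
  have hlip : LipschitzWith (1 / 2) φ := lipschitzWith_of_nnnorm_fderiv_le hdiff fun x => by
    rw [← NNReal.coe_le_coe]; simpa using hsmall x
  have happ : ApproximatesLinearOn Φ
      ((ContinuousLinearEquiv.refl ℝ (Euc n) : Euc n ≃L[ℝ] Euc n) : Euc n →L[ℝ] Euc n) univ
      (1 / 2) := by
    intro x _ y _
    have := hlip.norm_sub_le x y
    simp only [hΦ, ContinuousLinearEquiv.coe_refl, ContinuousLinearMap.coe_id', id_eq]
    rwa [add_sub_add_comm, add_sub_cancel_left]
  have hc : Subsingleton (Euc n) ∨ (1 / 2 : NNReal) <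
      ‖((ContinuousLinearEquiv.refl ℝ (Euc n)).symm : Euc n →L[ℝ] Euc n)‖₊⁻¹ := by
    rcases subsingleton_or_nontrivial (Euc n) with h | h
    · exact Or.inl h
    · right
      have : ‖((ContinuousLinearEquiv.refl ℝ (Euc n)).symm : Euc n →L[ℝ] Euc n)‖₊ = 1 := by
        rw [← NNReal.coe_inj]
        exact ContinuousLinearMap.norm_id
      rw [this, inv_one]
      exact NNReal.half_lt_self one_ne_zero
  let e : Euc n ≃ₜ Euc n := happ.toHomeomorph Φ hc
  have he : ∀ x, e x = Φ x := fun x => rfl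
  have hder : ∀ x, HasFDerivAt Φ (ContinuousLinearMap.id ℝ (Euc n) + fderiv ℝ φ x) x := fun x =>
    (hasFDerivAt_id x).add (hdiff x).hasFDerivAt
  have hequiv : IsEquivariant Φ := fun x m => by simp only [hΦ, hφ x m]; abel
  have h1 := integral_image_eq_integral_abs_det_fderiv_smul volume (measurable_cube n)
    (fun x _ => (hder x).hasFDerivWithinAt) (e.injective.injOn) ψ
  simp only [abs_of_pos (det_one_add_pos (hsmall _))] at h1
  have hQ : IsAddFundamentalDomain
      (Submodule.span ℤ (Set.range (EuclideanSpace.basisFun (Fin n) ℝ).toBasis)) (cube n)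
      (volume : Measure (Euc n)) := by
    rw [← fundamentalDomain_eq_cube]
    exact ZSpan.isAddFundamentalDomain _ _
  have hQ' : IsAddFundamentalDomain
      (Submodule.span ℤ (Set.range (EuclideanSpace.basisFun (Fin n) ℝ).toBasis)) (Φ '' cube n)
      (volume : Measure (Euc n)) := by
    refine IsAddFundamentalDomain.mk' ?_ ?_
    · exact (e.measurableEmbedding.measurableSet_image.2 (measurable_cube n)).nullMeasurableSet
    · intro y
      obtain ⟨x, rfl⟩ := e.surjective y
      have hiff : ∀ g : Submodule.span ℤ (Set.range (EuclideanSpace.basisFun (Fin n) ℝ).toBasis),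
          g +ᵥ e x ∈ Φ '' cube n ↔ g +ᵥ x ∈ cube n := by
        intro g
        obtain ⟨m, hm⟩ := (mem_span_basisFun_iff (g : Euc n)).1 g.2
        have : g +ᵥ e x = e (g +ᵥ x) := by
          simp only [Submodule.vadd_def, vadd_eq_add, hm, he]
          rw [add_comm, ← hequiv, add_comm]
        rw [this]
        exact e.injective.mem_set_image
      simp only [hiff]
      rw [← fundamentalDomain_eq_cube]
      exact ZSpan.exist_unique_vadd_mem_fundamentalDomain _ x
  have : VAddInvariantMeasure
      (Submodule.span ℤ (Set.range (EuclideanSpace.basisFun (Fin n) ℝ).toBasis)) (Euc n) volume :=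
    ⟨fun g s _ => measure_preimage_add volume (g : Euc n) s⟩
  rw [hQ.setIntegral_eq hQ' (f := ψ), h1]
  · simp [hΦ]
  · intro g x
    obtain ⟨m, hm⟩ := (mem_span_basisFun_iff (g : Euc n)).1 g.2
    simp only [Submodule.vadd_def, vadd_eq_add, hm]
    rw [add_comm, hψ]

/-- The integral over the cube of a function depending holomorphically on a parameter is an entire
function of the parameter. -/
lemma differentiable_integral_cube {n : ℕ} {H : Euc n → ℂ → ℂ}
    (hc : Continuous (Function.uncurry H)) (hd : ∀ x, Differentiable ℂ (H x)) :
    Differentiable ℂ fun t => ∫ x in cube n, H x t := by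
  intro t₀
  have hK : IsCompact (closure (cube n) ×ˢ Metric.closedBall t₀ 2) :=
    (bounded_cube n).isCompact_closure.prod (isCompact_closedBall _ _)
  obtain ⟨M, hM⟩ := hK.exists_bound_of_continuousOn hc.continuousOn
  have hbd : ∀ x ∈ cube n, ∀ t ∈ Metric.closedBall t₀ 2, ‖H x t‖ ≤ M := fun x hx t ht =>
    hM (x, t) ⟨subset_closure hx, ht⟩
  have hct : ∀ t, Continuous fun x => H x t := fun t =>
    hc.comp (Continuous.prodMk continuous_id continuous_const)
  refine (hasDerivAt_integral_of_dominated_loc_of_deriv_le (F := fun t x => H x t)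
    (F' := fun t x => deriv (H x) t) (bound := fun _ => M / 1) (Metric.ball_mem_nhds t₀ one_pos)
    (Filter.Eventually.of_forall fun t => (hct t).aestronglyMeasurable)
    ?_ ?_ ?_ ?_ ?_).2.differentiableAt
  · refine Integrable.of_bound (hct t₀).aestronglyMeasurable M ?_
    exact (ae_restrict_iff' (measurable_cube n)).2 (Filter.Eventually.of_forall fun x hx =>
      hbd x hx t₀ (Metric.mem_closedBall_self (by norm_num)))
  · exact ((measurable_deriv_with_param hc).comp
      (measurable_id.prodMk measurable_const)).aestronglyMeasurable
  · refine (ae_restrict_iff' (measurable_cube n)).2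
      (Filter.Eventually.of_forall fun x hx t ht => ?_)
    refine Complex.norm_deriv_le_of_forall_mem_sphere_norm_le one_pos (hd x).diffContOnCl ?_
    intro z hz
    refine hbd x hx z ?_
    rw [Metric.mem_closedBall]
    calc dist z t₀ ≤ dist z t + dist t t₀ := dist_triangle _ _ _
      _ ≤ 1 + 1 := add_le_add (Metric.mem_sphere.1 hz).le (Metric.mem_ball.1 ht).le
      _ = 2 := by norm_num
  · exact integrable_const _
  · exact Filter.Eventually.of_forall fun x t _ => (hd x t).hasDerivAt

lemma mFourier_proj {n : ℕ} (m : Fin n → ℤ) (x : Euc n) :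
    UnitAddTorus.mFourier m (proj n x) =
      Complex.exp (∑ i, 2 * Real.pi * Complex.I * m i * (x i : ℂ)) := by
  simp [UnitAddTorus.mFourier, proj, Complex.exp_sum]

/-- The degree formula, on characters: a `C¹` self-map of the torus homotopic to the identity
transports the signed measure of density its Jacobian to the volume. For maps close to the identity
this is a change of variables; in general it follows by analytic continuation along the
segment from the identity. -/
lemma integral_mFourier_mul_det {n : ℕ} {Φ : Euc n → Euc n} (hΦ : IsEquivariant Φ)
    (hd : ContDiff ℝ 1 Φ) (m : Fin n → ℤ) :
    ∫ x in cube n, ((fderiv ℝ Φ x).det : ℂ) * UnitAddTorus.mFourier m (proj n (Φ x)) =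
      ∫ x in cube n, UnitAddTorus.mFourier m (proj n x) := by
  set φ : Euc n → Euc n := fun x => Φ x - x with hφdef
  have hφ : IsPeriodic φ := hΦ.isPeriodic_sub
  have hdφ : ContDiff ℝ 1 φ := hd.sub contDiff_id
  have hcf : Continuous (fderiv ℝ φ) := hdφ.continuous_fderiv one_ne_zero
  obtain ⟨M, hM0, hM⟩ := hφ.fderiv.exists_bound hcf
  let b := (EuclideanSpace.basisFun (Fin n) ℝ).toBasis
  let A : Euc n → Matrix (Fin n) (Fin n) ℂ := fun x =>
    (LinearMap.toMatrix b b (fderiv ℝ φ x : Euc n →ₗ[ℝ] Euc n)).map Complex.ofReal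
  have hA : Continuous A := by
    refine continuous_matrix fun i j => ?_
    simp only [A, Matrix.map_apply, LinearMap.toMatrix_apply]
    refine Complex.continuous_ofReal.comp ?_
    exact ((EuclideanSpace.proj i : Euc n →L[ℝ] ℝ).continuous).comp
      (hcf.clm_apply continuous_const)
  have hφi : ∀ i, Continuous fun x => φ x i := fun i =>
    (EuclideanSpace.proj i : Euc n →L[ℝ] ℝ).continuous.comp hdφ.continuous
  have hxi : ∀ i, Continuous fun x : Euc n => x i := fun i =>
    (EuclideanSpace.proj i : Euc n →L[ℝ] ℝ).continuous
  -- the integrand for the map `id + t φ`, extended to complex `t`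
  let H : Euc n → ℂ → ℂ := fun x t => (1 + t • A x).det *
    Complex.exp (∑ i, 2 * Real.pi * Complex.I * m i * ((x i : ℂ) + t * (φ x i : ℂ)))
  have hHc : Continuous (Function.uncurry H) := by
    simp only [H, Function.uncurry_def]
    refine Continuous.mul ?_ ?_
    · refine Continuous.matrix_det ?_
      exact continuous_const.add (continuous_snd.smul (hA.comp continuous_fst))
    · refine Complex.continuous_exp.comp (continuous_finsetSum _ fun i _ => ?_)
      refine continuous_const.mul (Continuous.add ?_ (continuous_snd.mul ?_))
      · exact Complex.continuous_ofReal.comp ((hxi i).comp continuous_fst)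
      · exact Complex.continuous_ofReal.comp ((hφi i).comp continuous_fst)
  have hHd : ∀ x, Differentiable ℂ (H x) := by
    intro x
    simp only [H]
    refine Differentiable.mul ?_ (by fun_prop)
    simp only [Matrix.det_apply]
    refine Differentiable.fun_sum fun σ _ => ?_
    refine Differentiable.const_smul ?_ _
    refine Differentiable.fun_finsetProd fun i _ => ?_
    simp only [Matrix.add_apply, Matrix.smul_apply, smul_eq_mul]
    fun_prop
  have hreal : ∀ (t : ℝ) x, H x t =
      ((ContinuousLinearMap.id ℝ (Euc n) + fderiv ℝ (fun y => t • φ y) x).det : ℂ) *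
        UnitAddTorus.mFourier m (proj n (x + t • φ x)) := by
    intro t x
    simp only [H, mFourier_proj]
    congr 1
    · rw [fderiv_fun_const_smul (hdφ.differentiable one_ne_zero x)]
      rw [ContinuousLinearMap.det, ← LinearMap.det_toMatrix b]
      have := RingHom.map_det Complex.ofRealHom
        (LinearMap.toMatrix b b (ContinuousLinearMap.id ℝ (Euc n) + t • fderiv ℝ φ x :
          Euc n →L[ℝ] Euc n))
      refine Eq.trans ?_ this.symm
      congr 1
      simp only [A, ContinuousLinearMap.toLinearMap_add, ContinuousLinearMap.toLinearMap_smul,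
        ContinuousLinearMap.coe_id, map_add, LinearMap.toMatrix_id, map_smul]
      ext i j
      simp [Matrix.map_apply]
    · simp
  have hψ : IsPeriodic fun x => UnitAddTorus.mFourier m (proj n x) := fun x k => by
    simp only [isPeriodic_proj n x k]
  have hsmall : ∀ t : ℝ, |t| * M ≤ 1 / 2 →
      ∫ x in cube n, H x t = ∫ x in cube n, UnitAddTorus.mFourier m (proj n x) := by
    intro t ht
    simp only [hreal]
    refine integral_comp_mul_det_of_small (φ := fun y => t • φ y)
      (fun x k => by simp only [hφ x k]) (hdφ.const_smul t) (fun x => ?_) hψ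
    rw [fderiv_fun_const_smul (hdφ.differentiable one_ne_zero x), norm_smul]
    refine le_trans ?_ ht
    gcongr
    · rfl
    · exact hM x
  have hanal : AnalyticOnNhd ℂ (fun t => ∫ x in cube n, H x t) univ :=
    (differentiable_integral_cube hHc hHd).differentiableOn.analyticOnNhd isOpen_univ
  have heq := hanal.eq_of_frequently_eq (z₀ := 0)
    (g := fun _ => ∫ x in cube n, UnitAddTorus.mFourier m (proj n x)) analyticOnNhd_const ?_
  -- at `t = 1` the map is `Φ`
  · have h1 := congrFun heq ((1 : ℝ) : ℂ)
    simp only [hreal] at h1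
    rw [← h1]
    refine integral_congr_ae (Filter.Eventually.of_forall fun x => ?_)
    have hfd : fderiv ℝ Φ x = ContinuousLinearMap.id ℝ (Euc n) +
        fderiv ℝ (fun y => (1 : ℝ) • φ y) x := by
      simp only [one_smul, hφdef]
      rw [fderiv_fun_sub (hd.differentiable one_ne_zero x) differentiableAt_fun_id, fderiv_fun_id]
      abel
    simp only [hfd, hφdef, one_smul, add_sub_cancel]
  -- the real parameters `1 / (k + 1)` are eventually small, and accumulate at zero
  · have hseq : Filter.Tendsto (fun k : ℕ => (((1 : ℝ) / (k + 1) : ℝ) : ℂ)) Filter.atTop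
        (nhdsWithin 0 {0}ᶜ) := by
      refine tendsto_nhdsWithin_iff.2 ⟨?_, Filter.Eventually.of_forall fun k => ?_⟩
      · have := tendsto_one_div_add_atTop_nhds_zero_nat (𝕜 := ℝ)
        exact (Complex.continuous_ofReal.tendsto' 0 0 (by simp)).comp this
      · simp only [mem_compl_iff, mem_singleton_iff, Complex.ofReal_eq_zero]
        positivity
    refine hseq.frequently (Filter.Eventually.frequently ?_)
    have hlim : Filter.Tendsto (fun k : ℕ => (1 : ℝ) / (k + 1) * M) Filter.atTop (nhds 0) := by
      simpa using (tendsto_one_div_add_atTop_nhds_zero_nat (𝕜 := ℝ)).mul_const M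
    filter_upwards [hlim.eventually (gt_mem_nhds (show (0 : ℝ) < 1 / 2 by norm_num))] with k hk
    refine hsmall _ ?_
    rw [abs_of_pos (by positivity)]
    exact hk.le

/-! ### Mollification -/

open Filter Topology

lemma IsPeriodic.uniformContinuous {n : ℕ} {X : Type*} [PseudoMetricSpace X] {F : Euc n → X}
    (hF : IsPeriodic F) (hc : Continuous F) : UniformContinuous F := by
  obtain ⟨R, hR⟩ := (bounded_cube n).subset_closedBall 0
  have huc := (isCompact_closedBall (0 : Euc n) (R + 1)).uniformContinuousOn_of_continuous
    hc.continuousOn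
  rw [Metric.uniformContinuousOn_iff] at huc
  refine Metric.uniformContinuous_iff.2 fun ε hε => ?_
  obtain ⟨δ, hδ, h⟩ := huc ε hε
  refine ⟨min δ 1, lt_min hδ one_pos, fun x y hxy => ?_⟩
  obtain ⟨m, hm⟩ := exists_add_intVec_mem_cube x
  have hx := hR hm
  have hd : dist (x + intVec m) (y + intVec m) = dist x y := dist_add_right _ _ _
  rw [← hF x m, ← hF y m]
  refine h _ (Metric.closedBall_subset_closedBall (by linarith) hx) _ ?_
    (hd ▸ hxy.trans_le (min_le_left _ _))
  rw [Metric.mem_closedBall] at hx ⊢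
  have h1 : dist (y + intVec m) (x + intVec m) ≤ 1 := by
    rw [dist_comm, hd]; exact (hxy.trans_le (min_le_right _ _)).le
  linarith [dist_triangle (y + intVec m) (x + intVec m) 0]

lemma IsEquivariant.uniformContinuous {n : ℕ} {F : Euc n → Euc n} (hF : IsEquivariant F)
    (hc : Continuous F) : UniformContinuous F := by
  have := (hF.isPeriodic_sub.uniformContinuous (hc.sub continuous_id)).add uniformContinuous_id
  simpa using this

/-- The convolution of `g` with a normalised smooth bump centred at the origin. -/
def mollify {n : ℕ} {X : Type*} [NormedAddCommGroup X] [NormedSpace ℝ X]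
    (η : ContDiffBump (0 : Euc n)) (g : Euc n → X) : Euc n → X :=
  convolution (η.normed volume) g (ContinuousLinearMap.lsmul ℝ ℝ) volume

section Mollify

variable {n : ℕ} {X : Type*} [NormedAddCommGroup X] [NormedSpace ℝ X]
  (η : ContDiffBump (0 : Euc n))

lemma mollify_apply (g : Euc n → X) (x : Euc n) :
    mollify η g x = ∫ t, η.normed volume t • g (x - t) := rfl

lemma integrable_normed_smul {g : Euc n → X} (hg : LocallyIntegrable g) (x : Euc n) :
    Integrable fun t => η.normed volume t • g (x - t) :=
  η.hasCompactSupport_normed.convolutionExists_left (ContinuousLinearMap.lsmul ℝ ℝ)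
    η.continuous_normed hg x

lemma mollify_sub {g h : Euc n → X} (hg : LocallyIntegrable g) (hh : LocallyIntegrable h)
    (x : Euc n) : mollify η (fun y => g y - h y) x = mollify η g x - mollify η h x := by
  simp only [mollify_apply, smul_sub]
  exact integral_sub (integrable_normed_smul η hg x) (integrable_normed_smul η hh x)

lemma contDiff_mollify [CompleteSpace X] {g : Euc n → X} (hg : LocallyIntegrable g) :
    ContDiff ℝ 1 (mollify η g) :=
  η.hasCompactSupport_normed.contDiff_convolution_left (n := 1) _ η.contDiff_normed hg

lemma IsEquivariant.mollify {F : Euc n → Euc n} (hF : IsEquivariant F) (hc : Continuous F) :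
    IsEquivariant (mollify η F) := by
  intro x m
  have h : ∀ t, η.normed volume t • F (x + intVec m - t) =
      η.normed volume t • F (x - t) + η.normed volume t • intVec m := fun t => by
    rw [add_sub_right_comm, hF, smul_add]
  simp only [mollify_apply, h]
  rw [integral_add (integrable_normed_smul η hc.locallyIntegrable x)
    (η.integrable_normed.smul_const _), integral_smul_const, η.integral_normed, one_smul]

lemma fderiv_mollify_apply {F : Euc n → X} [CompleteSpace X] (hc : Continuous F) (x v : Euc n) :
    fderiv ℝ (mollify η F) x v = ∫ t, fderiv ℝ (η.normed volume) t v • F (x - t) := by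
  have h1 := (η.hasCompactSupport_normed (μ := volume)).hasFDerivAt_convolution_left
    (ContinuousLinearMap.lsmul ℝ ℝ : ℝ →L[ℝ] X →L[ℝ] X) (μ := volume)
    (η.contDiff_normed (n := 1)) hc.locallyIntegrable x
  have hint : Integrable fun t => ((ContinuousLinearMap.lsmul ℝ ℝ).precompL (Euc n)
      (fderiv ℝ (η.normed volume) t)) (F (x - t)) :=
    ((η.hasCompactSupport_normed (μ := volume)).fderiv ℝ).convolutionExists_left
      ((ContinuousLinearMap.lsmul ℝ ℝ : ℝ →L[ℝ] X →L[ℝ] X).precompL (Euc n))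
      ((η.contDiff_normed (n := 1)).continuous_fderiv one_ne_zero) hc.locallyIntegrable x
  have h2 := congrArg (fun T : Euc n →L[ℝ] X => T v) h1.fderiv
  refine h2.trans ((ContinuousLinearMap.integral_apply hint v).trans ?_)
  rfl

lemma fderiv_normed_sub (x y v : Euc n) :
    fderiv ℝ (fun y => η.normed volume (x - y)) y v =
      - fderiv ℝ (η.normed volume) (x - y) v := by
  have h := ((η.contDiff_normed (μ := volume) (n := 1)).differentiable one_ne_zero
    (x - y)).hasFDerivAt.comp y ((hasFDerivAt_id y).const_sub x)
  have h' := congrArg (fun T : Euc n →L[ℝ] ℝ => T v) h.fderiv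
  refine h'.trans ?_
  simp

/-- The derivative of a mollification is the mollification of the weak derivative. -/
lemma fderiv_mollify {F : Euc n → Euc n} {G : Euc n → Euc n →L[ℝ] Euc n} (hc : Continuous F)
    (hG : LocallyIntegrable G) (hw : HasWeakDifferential F G) (x : Euc n) :
    fderiv ℝ (DenjoyTori.mollify η F) x = DenjoyTori.mollify η G x := by
  ext1 v
  have hφ : ContDiff ℝ ∞ fun y => η.normed volume (x - y) :=
    η.contDiff_normed.comp (contDiff_const.sub contDiff_id)
  have hφs : HasCompactSupport fun y => η.normed volume (x - y) :=
    η.hasCompactSupport_normed.comp_homeomorph (Homeomorph.subLeft x)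
  have h3 := hw _ hφ hφs v
  simp only [fderiv_normed_sub, neg_smul, integral_neg, neg_inj] at h3
  have hR : DenjoyTori.mollify η G x v = ∫ t, η.normed volume t • G (x - t) v := by
    rw [mollify_apply]
    exact ContinuousLinearMap.integral_apply (integrable_normed_smul η hG x) v
  rw [fderiv_mollify_apply η hc, hR,
    ← integral_sub_left_eq_self (fun t => fderiv ℝ (η.normed volume) t v • F (x - t)) volume x,
    ← integral_sub_left_eq_self (fun t => η.normed volume t • G (x - t) v) volume x]
  simp only [sub_sub_cancel]
  exact h3

/-- Young's inequality for averages: mollification does not increase the `Lᵏ` norm. -/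
lemma eLpNorm_mollify_le [MeasurableSpace X] [BorelSpace X] [SecondCountableTopology X]
    {k : ℕ} (hk : 1 ≤ k) {g : Euc n → X} (hg : Measurable g) :
    eLpNorm (mollify η g) k volume ≤ eLpNorm g k volume := by
  have hk0 : (k : ENNReal) ≠ 0 := by simpa using (by omega : k ≠ 0)
  have hkR : (0 : ℝ) < k := by exact_mod_cast hk
  set P : Measure (Euc n) := volume.withDensity fun t => ENNReal.ofReal (η.normed volume t) with hP
  have hηm : Measurable fun t => ENNReal.ofReal (η.normed volume t) :=
    η.continuous_normed.measurable.ennreal_ofReal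
  have hprob : IsProbabilityMeasure P := ⟨by
    rw [hP, withDensity_apply _ MeasurableSet.univ, Measure.restrict_univ,
      ← ofReal_integral_eq_lintegral_ofReal η.integrable_normed
        (Eventually.of_forall fun t => η.nonneg_normed t), η.integral_normed, ENNReal.ofReal_one]⟩
  have hgx : ∀ x, Measurable fun t => g (x - t) := fun x =>
    hg.comp (measurable_const.sub measurable_id)
  have hpt : ∀ x, ‖mollify η g x‖ₑ ^ (k : ℝ) ≤ ∫⁻ t, ‖g (x - t)‖ₑ ^ (k : ℝ) ∂P := by
    intro x
    have h1 : ‖mollify η g x‖ₑ ≤ ∫⁻ t, ‖g (x - t)‖ₑ ∂P := by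
      rw [mollify_apply]
      refine (enorm_integral_le_lintegral_enorm _).trans_eq ?_
      rw [hP, lintegral_withDensity_eq_lintegral_mul _ hηm (hgx x).enorm]
      refine lintegral_congr fun t => ?_
      rw [enorm_smul, Pi.mul_apply, Real.enorm_of_nonneg (η.nonneg_normed t)]
    have h2 := eLpNorm_le_eLpNorm_of_exponent_le (μ := P) (p := 1) (q := k)
      (by exact_mod_cast hk) (hgx x).aestronglyMeasurable
    rw [eLpNorm_one_eq_lintegral_enorm, eLpNorm_eq_lintegral_rpow_enorm_toReal hk0 (by simp)] at h2
    simp only [ENNReal.toReal_natCast] at h2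
    have h3 := ENNReal.rpow_le_rpow (h1.trans h2) hkR.le
    rwa [← ENNReal.rpow_mul, one_div, inv_mul_cancel₀ hkR.ne', ENNReal.rpow_one] at h3
  rw [eLpNorm_eq_lintegral_rpow_enorm_toReal hk0 (by simp),
    eLpNorm_eq_lintegral_rpow_enorm_toReal hk0 (by simp)]
  simp only [ENNReal.toReal_natCast]
  refine ENNReal.rpow_le_rpow ?_ (by positivity)
  calc ∫⁻ x, ‖mollify η g x‖ₑ ^ (k : ℝ) ≤ ∫⁻ x, ∫⁻ t, ‖g (x - t)‖ₑ ^ (k : ℝ) ∂P :=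
        lintegral_mono hpt
    _ = ∫⁻ t, (∫⁻ x, ‖g (x - t)‖ₑ ^ (k : ℝ)) ∂P := by
        refine lintegral_lintegral_swap (f := fun x t => ‖g (x - t)‖ₑ ^ (k : ℝ)) ?_
        exact ((hg.comp (measurable_fst.sub measurable_snd)).enorm.pow_const _).aemeasurable
    _ = ∫⁻ _, (∫⁻ x, ‖g x‖ₑ ^ (k : ℝ)) ∂P := by
        refine lintegral_congr fun t => ?_
        exact lintegral_sub_right_eq_self (μ := volume) (fun x => ‖g x‖ₑ ^ (k : ℝ)) t
    _ = ∫⁻ x, ‖g x‖ₑ ^ (k : ℝ) := by simp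

end Mollify

/-- Bumps centred at the origin, with supports shrinking to the origin. -/
def shrinkingBump (n j : ℕ) : ContDiffBump (0 : Euc n) where
  rIn := 1 / (2 * (j + 1))
  rOut := 1 / (j + 1)
  rIn_pos := by positivity
  rIn_lt_rOut := by
    apply one_div_lt_one_div_of_lt <;> nlinarith [(Nat.cast_nonneg j : (0 : ℝ) ≤ j)]

lemma tendsto_rOut_shrinkingBump (n : ℕ) :
    Tendsto (fun j => (shrinkingBump n j).rOut) atTop (𝓝 0) :=
  tendsto_one_div_add_atTop_nhds_zero_nat

lemma rOut_shrinkingBump_le (n j : ℕ) : (shrinkingBump n j).rOut ≤ 1 := by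
  simp only [shrinkingBump]
  rw [div_le_one (by positivity)]
  linarith [(Nat.cast_nonneg j : (0 : ℝ) ≤ j)]

/-- Mollifications of a uniformly continuous map converge uniformly. -/
lemma eventually_dist_mollify_le {n : ℕ} {X : Type*} [NormedAddCommGroup X] [NormedSpace ℝ X]
    [CompleteSpace X] {g : Euc n → X} (hg : UniformContinuous g) {ε : ℝ} (hε : 0 < ε) :
    ∀ᶠ j in atTop, ∀ x, ‖mollify (shrinkingBump n j) g x - g x‖ ≤ ε := by
  obtain ⟨δ, hδ, h⟩ := Metric.uniformContinuous_iff.1 hg ε hε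
  filter_upwards [(tendsto_rOut_shrinkingBump n).eventually (gt_mem_nhds hδ)] with j hj x
  rw [← dist_eq_norm]
  refine (shrinkingBump n j).dist_normed_convolution_le
    hg.continuous.aestronglyMeasurable fun y hy => ?_
  exact (h ((Metric.mem_ball.1 hy).trans hj)).le

/-- Mollifications of a map which is locally in `Lᵏ` converge in `Lᵏ` of the cube. -/
lemma tendsto_eLpNorm_mollify_sub {n : ℕ} {X : Type*} [NormedAddCommGroup X] [NormedSpace ℝ X]
    [CompleteSpace X] [MeasurableSpace X] [BorelSpace X] [SecondCountableTopology X]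
    {k : ℕ} (hk : 1 ≤ k) {G : Euc n → X} (hG : Measurable G)
    (hLp : ∀ A : Set (Euc n), IsCompact A → MemLp G k (volume.restrict A)) :
    Tendsto (fun j => eLpNorm (fun x => mollify (shrinkingBump n j) G x - G x) k
      (volume.restrict (cube n))) atTop (𝓝 0) := by
  have hk1 : (1 : ENNReal) ≤ k := by exact_mod_cast hk
  have hloc : ∀ {g : Euc n → X}, (MemLp g k volume) → LocallyIntegrable g := fun hg =>
    hg.locallyIntegrable hk1
  obtain ⟨R, hR⟩ := (bounded_cube n).subset_closedBall 0
  set g : Euc n → X := (Metric.closedBall (0 : Euc n) (R + 1)).indicator G with hgdef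
  have hgm : Measurable g := hG.indicator Metric.isClosed_closedBall.measurableSet
  have hgL : MemLp g k volume :=
    (memLp_indicator_iff_restrict Metric.isClosed_closedBall.measurableSet).2
      (hLp _ (isCompact_closedBall _ _))
  have hGg : ∀ x ∈ cube n, ∀ t, ‖t‖ ≤ 1 → G (x - t) = g (x - t) := by
    intro x hx t ht
    rw [hgdef, indicator_of_mem]
    have := hR hx
    rw [mem_closedBall_zero_iff] at this ⊢
    linarith [norm_sub_le x t]
  have hmol : ∀ j, ∀ x ∈ cube n,
      mollify (shrinkingBump n j) G x = mollify (shrinkingBump n j) g x := by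
    intro j x hx
    rw [mollify_apply, mollify_apply]
    refine integral_congr_ae (Eventually.of_forall fun t => ?_)
    by_cases ht : ‖t‖ ≤ 1
    · simp only [hGg x hx t ht]
    · have : (shrinkingBump n j).normed volume t = 0 := by
        rw [← Function.notMem_support, ContDiffBump.support_normed_eq, mem_ball_zero_iff]
        linarith [rOut_shrinkingBump_le n j, not_le.1 ht]
      simp only [this, zero_smul]
  refine ENNReal.tendsto_nhds_zero.2 fun ε hε => ?_
  by_cases hεt : ε = ⊤
  · simp [hεt]
  have hε3 : ε / 3 ≠ 0 := (ENNReal.div_pos hε.ne' (by simp)).ne'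
  have hε3t : ε / 3 ≠ ⊤ := ENNReal.div_ne_top hεt (by simp)
  obtain ⟨c, hcs, hgc, hcc, hcL⟩ := hgL.exists_hasCompactSupport_eLpNorm_sub_le (by simp) hε3
  have hcu : UniformContinuous c := hcs.uniformContinuous_of_continuous hcc
  filter_upwards [eventually_dist_mollify_le hcu (ENNReal.toReal_pos hε3 hε3t)] with j hj
  have hcm : Measurable c := hcc.measurable
  have hms : Measurable (fun x => mollify (shrinkingBump n j) (fun y => g y - c y) x) :=
    (contDiff_mollify _ (hloc (hgL.sub hcL))).continuous.measurable
  have hms' : Measurable (fun x => mollify (shrinkingBump n j) c x - c x) :=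
    ((contDiff_mollify _ (hloc hcL)).continuous.sub hcc).measurable
  have hdecomp : ∀ x ∈ cube n, mollify (shrinkingBump n j) G x - G x =
      (mollify (shrinkingBump n j) (fun y => g y - c y) x +
        (mollify (shrinkingBump n j) c x - c x)) + (c x - g x) := by
    intro x hx
    have h0 := hGg x hx 0 (by simp)
    rw [sub_zero] at h0
    rw [hmol j x hx, mollify_sub _ (hloc hgL) (hloc hcL), h0]
    abel
  rw [eLpNorm_congr_ae ((ae_restrict_iff' (measurable_cube n)).2 (Eventually.of_forall hdecomp))]
  have e1 : eLpNorm (mollify (shrinkingBump n j) (fun y => g y - c y)) k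
      (volume.restrict (cube n)) ≤ ε / 3 :=
    (eLpNorm_mono_measure _ Measure.restrict_le_self).trans
      ((eLpNorm_mollify_le _ hk (hgm.sub hcm)).trans hgc)
  have e2 : eLpNorm (fun x => mollify (shrinkingBump n j) c x - c x) k
      (volume.restrict (cube n)) ≤ ε / 3 := by
    refine (eLpNorm_le_of_ae_bound (Eventually.of_forall hj)).trans ?_
    rw [ENNReal.ofReal_toReal hε3t, measure_univ, ENNReal.one_rpow, one_mul]
  have e3 : eLpNorm (fun x => c x - g x) k (volume.restrict (cube n)) ≤ ε / 3 := by
    refine (eLpNorm_mono_measure _ Measure.restrict_le_self).trans ?_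
    exact (eLpNorm_sub_comm c g k volume).trans_le hgc
  calc _ ≤ _ := eLpNorm_add_le (hms.add hms').aestronglyMeasurable
        (hcm.sub hgm).aestronglyMeasurable hk1
    _ ≤ (ε / 3 + ε / 3) + ε / 3 := by
        refine add_le_add ?_ e3
        exact (eLpNorm_add_le hms.aestronglyMeasurable hms'.aestronglyMeasurable hk1).trans
          (add_le_add e1 e2)
    _ = ε := ENNReal.add_thirds ε

/-- An equivariant Sobolev map is approximated, uniformly and in the Sobolev norm, by equivariant
`C¹` maps. -/
lemma exists_smooth_approx {n : ℕ} (hn : 1 ≤ n) {F : Euc n → Euc n}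
    {G : Euc n → Euc n →L[ℝ] Euc n} (hF : Continuous F) (hFe : IsEquivariant F)
    (hG : Measurable G) (hw : HasWeakDifferential F G) (hL : LocallyLn G) :
    ∃ Φ : ℕ → Euc n → Euc n, (∀ j, ContDiff ℝ 1 (Φ j)) ∧ (∀ j, IsEquivariant (Φ j)) ∧
      (∀ ε > 0, ∀ᶠ j in atTop, ∀ x, ‖Φ j x - F x‖ ≤ ε) ∧
      Tendsto (fun j => eLpNorm (fun x => fderiv ℝ (Φ j) x - G x) n (volume.restrict (cube n)))
        atTop (𝓝 0) := by
  have hGl : LocallyIntegrable G := by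
    rw [locallyIntegrable_iff]
    intro A hA
    have : IsFiniteMeasure (volume.restrict A) := ⟨by simpa using hA.measure_lt_top⟩
    exact (hL A hA).integrable (by exact_mod_cast hn)
  refine ⟨fun j => mollify (shrinkingBump n j) F, fun j => contDiff_mollify _ hF.locallyIntegrable,
    fun j => hFe.mollify _ hF, fun ε hε => eventually_dist_mollify_le (hFe.uniformContinuous hF) hε,
    ?_⟩
  simp only [fderiv_mollify _ hF hGl hw]
  exact tendsto_eLpNorm_mollify_sub hn hG hL

/-! ### The degree formula for Sobolev maps -/

/-- A weighted Young inequality. -/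
lemma mul_pow_le_add {a b δ : ENNReal} (hδ : δ ≠ 0) (hδ' : δ ≠ ⊤) (d : ℕ) :
    a * b ^ d ≤ δ * b ^ (d + 1) + δ⁻¹ ^ d * a ^ (d + 1) := by
  rcases le_total a (δ * b) with h | h
  · refine le_add_right ?_
    calc a * b ^ d ≤ δ * b * b ^ d := by gcongr
      _ = δ * b ^ (d + 1) := by ring
  · refine le_add_left ?_
    have hb : b ≤ δ⁻¹ * a := by
      calc b = δ⁻¹ * (δ * b) := by rw [← mul_assoc, ENNReal.inv_mul_cancel hδ hδ', one_mul]
        _ ≤ δ⁻¹ * a := by gcongr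
    calc a * b ^ d ≤ a * (δ⁻¹ * a) ^ d := by gcongr
      _ = δ⁻¹ ^ d * a ^ (d + 1) := by ring

/-- The determinant is locally Lipschitz, with a constant homogeneous of degree `n - 1`. -/
lemma exists_norm_det_sub_le (n : ℕ) : ∃ C : NNReal, ∀ A B : Euc n →L[ℝ] Euc n,
    ‖A.det - B.det‖ₑ ≤ C * (‖A - B‖ₑ * (‖A‖ₑ + ‖B‖ₑ) ^ (n - 1)) := by
  let b := (EuclideanSpace.basisFun (Fin n) ℝ).toBasis
  let D : ContinuousMultilinearMap ℝ (fun _ : Fin n => Euc n) ℝ :=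
    ⟨b.det.toMultilinearMap, by
      have h : Continuous fun v : Fin n → Euc n => (b.toMatrix v).det := by
        refine Continuous.matrix_det (continuous_matrix fun i j => ?_)
        exact (EuclideanSpace.proj i : Euc n →L[ℝ] ℝ).continuous.comp (continuous_apply j)
      exact h⟩
  have hD : ∀ A : Euc n →L[ℝ] Euc n, A.det = D fun i => A (b i) := by
    intro A
    have := b.det_comp (A : Euc n →ₗ[ℝ] Euc n) b
    rw [Module.Basis.det_self, mul_one] at this
    exact this.symm
  have hb : ∀ i, ‖b i‖ = 1 := fun i => by simp [b]
  have hn : ∀ A : Euc n →L[ℝ] Euc n, ‖fun i => A (b i)‖ ≤ ‖A‖ := fun A =>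
    (pi_norm_le_iff_of_nonneg (norm_nonneg _)).2 fun i => by
      simpa [hb] using A.le_opNorm (b i)
  refine ⟨⟨‖D‖ * n, by positivity⟩, fun A B => ?_⟩
  have h := D.norm_image_sub_le (fun i => A (b i)) (fun i => B (b i))
  have h1 : ‖A.det - B.det‖ ≤ ‖D‖ * n * (‖A - B‖ * (‖A‖ + ‖B‖) ^ (n - 1)) := by
    rw [hD, hD]
    refine h.trans ?_
    have h2 : (fun i => A (b i)) - (fun i => B (b i)) = fun i => (A - B) (b i) := rfl
    rw [h2, Fintype.card_fin]
    have h3 : max ‖fun i => A (b i)‖ ‖fun i => B (b i)‖ ≤ ‖A‖ + ‖B‖ :=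
      max_le ((hn A).trans (by linarith [norm_nonneg B]))
        ((hn B).trans (by linarith [norm_nonneg A]))
    calc _ ≤ ‖D‖ * n * (‖A‖ + ‖B‖) ^ (n - 1) * ‖A - B‖ := by
          gcongr
          exact hn _
      _ = _ := by ring
  have h2 := ENNReal.ofReal_le_ofReal h1
  rw [ofReal_norm, ENNReal.ofReal_mul (p := ‖D‖ * n) (by positivity),
    ENNReal.ofReal_mul (p := ‖A - B‖) (by positivity), ENNReal.ofReal_pow (by positivity),
    ENNReal.ofReal_add (by positivity) (by positivity),
    ofReal_norm, ofReal_norm, ofReal_norm] at h2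
  refine h2.trans_eq ?_
  congr 1
  exact ENNReal.ofReal_eq_coe_nnreal _

lemma add_pow_le_two_pow_mul (a b : ENNReal) (k : ℕ) :
    (a + b) ^ k ≤ 2 ^ k * (a ^ k + b ^ k) := by
  rcases le_total a b with h | h
  · calc (a + b) ^ k ≤ (2 * b) ^ k := by rw [two_mul]; gcongr
      _ ≤ _ := by rw [mul_pow]; gcongr; exact le_add_self
  · calc (a + b) ^ k ≤ (2 * a) ^ k := by rw [two_mul]; gcongr
      _ ≤ _ := by rw [mul_pow]; gcongr; exact le_self_add

lemma eLpNorm_natCast_pow {α X : Type*} [MeasurableSpace α] [NormedAddCommGroup X] {μ : Measure α}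
    {k : ℕ} (hk : k ≠ 0) (g : α → X) : eLpNorm g k μ ^ k = ∫⁻ x, ‖g x‖ₑ ^ k ∂μ := by
  have hk0 : (k : ENNReal) ≠ 0 := by simpa using hk
  rw [eLpNorm_eq_lintegral_rpow_enorm_toReal hk0 (by simp)]
  simp only [ENNReal.toReal_natCast, ENNReal.rpow_natCast]
  rw [← ENNReal.rpow_natCast, ← ENNReal.rpow_mul, one_div, inv_mul_cancel₀ (by exact_mod_cast hk),
    ENNReal.rpow_one]

/-- Jacobian determinants depend continuously, in `L¹`, on the differential in `Lⁿ`. -/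
lemma tendsto_lintegral_det_sub {n : ℕ} (hn : 1 ≤ n) {α : Type*} [MeasurableSpace α]
    {μ : Measure α} {A : ℕ → α → Euc n →L[ℝ] Euc n} {G : α → Euc n →L[ℝ] Euc n}
    (hA : ∀ j, Measurable (A j)) (hG : Measurable G) (hGL : eLpNorm G n μ ≠ ⊤)
    (hlim : Tendsto (fun j => eLpNorm (fun x => A j x - G x) n μ) atTop (𝓝 0)) :
    Tendsto (fun j => ∫⁻ x, ‖(A j x).det - (G x).det‖ₑ ∂μ) atTop (𝓝 0) := by
  obtain ⟨d, rfl⟩ : ∃ d, n = d + 1 := ⟨n - 1, by omega⟩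
  obtain ⟨C, hC⟩ := exists_norm_det_sub_le (d + 1)
  simp only [Nat.add_sub_cancel] at hC
  set S : ENNReal := ∫⁻ x, ‖G x‖ₑ ^ (d + 1) ∂μ with hS
  have hSt : S ≠ ⊤ := by
    rw [hS, ← eLpNorm_natCast_pow d.succ_ne_zero]
    exact ENNReal.pow_ne_top hGL
  set D : ℕ → ENNReal := fun j => ∫⁻ x, ‖A j x - G x‖ₑ ^ (d + 1) ∂μ with hDdef
  have hD : Tendsto D atTop (𝓝 0) := by
    have := ENNReal.Tendsto.pow (n := d + 1) hlim
    simp only [eLpNorm_natCast_pow d.succ_ne_zero] at this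
    simpa using this
  -- the pointwise bound, with `‖A‖ ≤ ‖G‖ + ‖A - G‖`
  have hpt : ∀ (δ : ENNReal), δ ≠ 0 → δ ≠ ⊤ → ∀ j, ∫⁻ x, ‖(A j x).det - (G x).det‖ₑ ∂μ ≤
      C * (δ * (2 ^ (d + 1) * (2 ^ (d + 1) * S + D j)) + δ⁻¹ ^ d * D j) := by
    intro δ hδ hδ' j
    have hm1 : Measurable fun x => ‖A j x - G x‖ₑ ^ (d + 1) :=
      ((hA j).sub hG).enorm.pow_const _
    have hm2 : Measurable fun x => ‖G x‖ₑ ^ (d + 1) := hG.enorm.pow_const _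
    calc ∫⁻ x, ‖(A j x).det - (G x).det‖ₑ ∂μ ≤ ∫⁻ x, C * (δ * (2 ^ (d + 1) *
          (2 ^ (d + 1) * ‖G x‖ₑ ^ (d + 1) + ‖A j x - G x‖ₑ ^ (d + 1))) +
            δ⁻¹ ^ d * ‖A j x - G x‖ₑ ^ (d + 1)) ∂μ := by
          refine lintegral_mono fun x => (hC _ _).trans ?_
          gcongr
          refine (mul_pow_le_add hδ hδ' d).trans ?_
          gcongr
          have h1 : ‖A j x‖ₑ + ‖G x‖ₑ ≤ 2 * ‖G x‖ₑ + ‖A j x - G x‖ₑ := by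
            have : ‖A j x‖ₑ ≤ ‖A j x - G x‖ₑ + ‖G x‖ₑ := by
              simpa using enorm_add_le (A j x - G x) (G x)
            calc _ ≤ ‖A j x - G x‖ₑ + ‖G x‖ₑ + ‖G x‖ₑ := by gcongr
              _ = _ := by ring
          refine (pow_le_pow_left' h1 _).trans ?_
          rw [← mul_pow]
          exact add_pow_le_two_pow_mul _ _ _
      _ = _ := by
          rw [lintegral_const_mul _ (by fun_prop), lintegral_add_left (by fun_prop),
            lintegral_const_mul _ (by fun_prop), lintegral_const_mul _ (by fun_prop),
            lintegral_add_left (by fun_prop), lintegral_const_mul _ hm2,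
            lintegral_const_mul _ hm1]
  refine ENNReal.tendsto_nhds_zero.2 fun ε hε => ?_
  by_cases hεt : ε = ⊤
  · simp [hεt]
  -- choose `δ` with `C δ 2ⁿ (2ⁿ S + 1) ≤ ε / 2`
  set T : ENNReal := C * (2 ^ (d + 1) * (2 ^ (d + 1) * S + 1)) with hT
  have hTt : T ≠ ⊤ := by
    refine ENNReal.mul_ne_top ENNReal.coe_ne_top (ENNReal.mul_ne_top (by simp) ?_)
    exact ENNReal.add_ne_top.2 ⟨ENNReal.mul_ne_top (by simp) hSt, by simp⟩
  have hε2 : 0 < ε / 2 := ENNReal.half_pos hε.ne'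
  obtain ⟨δ, hδ0, hδ⟩ : ∃ δ : NNReal, 0 < δ ∧ (δ : ENNReal) * T ≤ ε / 2 := by
    obtain ⟨δ, hδ0, hδ⟩ := ENNReal.exists_nnreal_pos_mul_lt hTt hε2.ne'
    exact ⟨δ, hδ0, hδ.le⟩
  have hδ0' : (δ : ENNReal) ≠ 0 := by exact_mod_cast hδ0.ne'
  have hc : Tendsto (fun j => (C : ENNReal) * ((δ : ENNReal)⁻¹ ^ d * D j)) atTop (𝓝 0) := by
    have h1 : Tendsto (fun j => (δ : ENNReal)⁻¹ ^ d * D j) atTop (𝓝 0) := by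
      simpa using ENNReal.Tendsto.const_mul (a := (δ : ENNReal)⁻¹ ^ d) hD
        (Or.inr (ENNReal.pow_ne_top (ENNReal.inv_ne_top.2 hδ0')))
    simpa using ENNReal.Tendsto.const_mul (a := (C : ENNReal)) h1 (Or.inr ENNReal.coe_ne_top)
  filter_upwards [ENNReal.tendsto_nhds_zero.1 hc _ hε2,
    ENNReal.tendsto_nhds_zero.1 hD 1 one_pos] with j hj1 hj2
  calc _ ≤ _ := hpt δ hδ0' ENNReal.coe_ne_top j
    _ ≤ C * (δ * (2 ^ (d + 1) * (2 ^ (d + 1) * S + 1)) + (δ : ENNReal)⁻¹ ^ d * D j) := by gcongr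
    _ = δ * T + C * ((δ : ENNReal)⁻¹ ^ d * D j) := by rw [hT]; ring
    _ ≤ ε / 2 + ε / 2 := add_le_add hδ hj1
    _ = ε := ENNReal.add_halves ε

/-- Finite measures on the torus with the same Fourier coefficients are equal. -/
lemma measure_ext_of_mFourier {n : ℕ} {P P' : Measure (Torus n)} [IsFiniteMeasure P]
    [IsFiniteMeasure P']
    (h : ∀ m : Fin n → ℤ, ∫ p, UnitAddTorus.mFourier m p ∂P = ∫ p, UnitAddTorus.mFourier m p ∂P') :
    P = P' := by
  let A : StarSubalgebra ℂ (BoundedContinuousFunction (Torus n) ℂ) :=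
    (UnitAddTorus.mFourierSubalgebra (Fin n)).comap
      (BoundedContinuousFunction.toContinuousMapStarₐ ℂ)
  refine ext_of_forall_mem_subalgebra_integral_eq_of_pseudoEMetric_complete_countable (A := A)
    ?_ ?_
  · intro x y hxy
    obtain ⟨_, ⟨f, hf, rfl⟩, hfxy⟩ := UnitAddTorus.mFourierSubalgebra_separatesPoints hxy
    exact ⟨f, ⟨f, ⟨BoundedContinuousFunction.mkOfCompact f, hf, rfl⟩, rfl⟩, hfxy⟩
  · intro g hg
    have hint : ∀ (Q : Measure (Torus n)) [IsFiniteMeasure Q] (f : C(Torus n, ℂ)),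
        Integrable f Q := fun Q _ f =>
      (BoundedContinuousFunction.mkOfCompact f).integrable Q
    have hspan : ∀ f ∈ Submodule.span ℂ (range (UnitAddTorus.mFourier (d := Fin n))),
        ∫ p, f p ∂P = ∫ p, f p ∂P' := by
      intro f hf
      induction hf using Submodule.span_induction with
      | mem x hx => obtain ⟨m, rfl⟩ := hx; exact h m
      | zero => simp
      | add x y _ _ hx hy =>
        simp only [ContinuousMap.add_apply]
        rw [integral_add (hint P x) (hint P y), integral_add (hint P' x) (hint P' y), hx, hy]
      | smul c x _ hx =>
        simp only [ContinuousMap.smul_apply]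
        rw [integral_smul, integral_smul, hx]
    refine hspan g.toContinuousMap ?_
    rw [← UnitAddTorus.mFourierSubalgebra_coe]
    exact hg

/-- The degree formula for Sobolev maps of the torus homotopic to the identity: the pushforward
of the measure whose density is the Jacobian is the volume. -/
lemma lintegral_det_mul_comp {n : ℕ} (hn : 1 ≤ n) {F : Euc n → Euc n}
    {G : Euc n → Euc n →L[ℝ] Euc n} (hF : Continuous F) (hFe : IsEquivariant F)
    (hG : Measurable G) (hw : HasWeakDifferential F G) (hL : LocallyLn G)
    (hdet : ∀ᵐ x, 0 ≤ (G x).det) {Ψ : Torus n → ENNReal} (hΨ : Measurable Ψ) :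
    ∫⁻ x in cube n, ENNReal.ofReal (G x).det * Ψ (proj n (F x)) =
      ∫⁻ x in cube n, Ψ (proj n x) := by
  obtain ⟨Φ, hΦd, hΦe, hΦu, hΦL⟩ := exists_smooth_approx hn hF hFe hG hw hL
  set μ := (volume : Measure (Euc n)).restrict (cube n) with hμ
  have hGμ : eLpNorm G n μ ≠ ⊤ := by
    have h1 := (hL _ (bounded_cube n).isCompact_closure).2.ne
    exact ((eLpNorm_mono_measure _ (Measure.restrict_mono subset_closure le_rfl)).trans_lt
      h1.lt_top).ne
  have hmG : Measurable fun x => (G x).det := ContinuousLinearMap.continuous_det.measurable.comp hG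
  have hmΦ : ∀ j, Measurable (fderiv ℝ (Φ j)) := fun j =>
    ((hΦd j).continuous_fderiv one_ne_zero).measurable
  have hdetlim := tendsto_lintegral_det_sub hn hmΦ hG hGμ hΦL
  have hcΦ : ∀ j, Continuous fun x => (fderiv ℝ (Φ j) x).det := fun j =>
    ContinuousLinearMap.continuous_det.comp ((hΦd j).continuous_fderiv one_ne_zero)
  have hintcube : ∀ {g : Euc n → ℂ}, Continuous g → Integrable g μ := fun hg =>
    (hg.locallyIntegrable.integrableOn_isCompact (bounded_cube n).isCompact_closure).mono_set
      subset_closure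
  have hintdet : Integrable (fun x => (G x).det) μ := by
    refine ⟨hmG.aestronglyMeasurable, ?_⟩
    obtain ⟨j, hj⟩ := (ENNReal.tendsto_nhds_zero.1 hdetlim 1 one_pos).exists
    have hfin : ∫⁻ x, ‖(fderiv ℝ (Φ j) x).det‖ₑ ∂μ < ⊤ := by
      have := (hintcube (Complex.continuous_ofReal.comp (hcΦ j))).2
      refine lt_of_le_of_lt (lintegral_mono fun x => ?_) this
      simp [← ofReal_norm]
    calc ∫⁻ x, ‖(G x).det‖ₑ ∂μ ≤ ∫⁻ x, (‖(fderiv ℝ (Φ j) x).det - (G x).det‖ₑ +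
          ‖(fderiv ℝ (Φ j) x).det‖ₑ) ∂μ := by
          refine lintegral_mono fun x => ?_
          rw [← enorm_neg ((fderiv ℝ (Φ j) x).det - (G x).det)]
          simpa using enorm_add_le (-((fderiv ℝ (Φ j) x).det - (G x).det))
            ((fderiv ℝ (Φ j) x).det)
      _ = _ := lintegral_add_left ((hcΦ j).measurable.sub hmG).enorm _
      _ < ⊤ := ENNReal.add_lt_top.2 ⟨hj.trans_lt ENNReal.one_lt_top, hfin⟩
  have hpF : Measurable fun x => proj n (F x) := ((continuous_proj n).comp hF).measurable
  -- passage to the limit in the Fourier coefficients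
  have hchar : ∀ m : Fin n → ℤ,
      ∫ x, ((G x).det : ℂ) * UnitAddTorus.mFourier m (proj n (F x)) ∂μ =
        ∫ x, UnitAddTorus.mFourier m (proj n x) ∂μ := by
    intro m
    have hχ : ∀ p : Torus n, ‖UnitAddTorus.mFourier m p‖ₑ ≤ 1 := fun p => by
      rw [← ofReal_norm, ← ENNReal.ofReal_one]
      exact ENNReal.ofReal_le_ofReal
        (((UnitAddTorus.mFourier m).norm_coe_le_norm p).trans_eq UnitAddTorus.mFourier_norm)
    have hχm : Measurable (UnitAddTorus.mFourier m : Torus n → ℂ) :=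
      (UnitAddTorus.mFourier m).continuous.measurable
    have hcχ : ∀ j, Continuous fun x => UnitAddTorus.mFourier m (proj n (Φ j x)) := fun j =>
      (UnitAddTorus.mFourier m).continuous.comp ((continuous_proj n).comp (hΦd j).continuous)
    have hpt : ∀ x, Tendsto (fun j => Φ j x) atTop (𝓝 (F x)) := fun x =>
      tendsto_iff_norm_sub_tendsto_zero.2 (Metric.tendsto_nhds.2 fun ε hε => by
        filter_upwards [hΦu (ε / 2) (half_pos hε)] with j hj
        rw [dist_zero_right, norm_norm]
        exact (hj x).trans_lt (half_lt_self hε))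
    have h2 : Tendsto (fun j => ∫⁻ x, ‖(G x).det‖ₑ * ‖UnitAddTorus.mFourier m (proj n (Φ j x)) -
        UnitAddTorus.mFourier m (proj n (F x))‖ₑ ∂μ) atTop (𝓝 0) := by
      have h0 : (0 : ENNReal) = ∫⁻ _, 0 ∂μ := by simp
      rw [h0]
      refine tendsto_lintegral_of_dominated_convergence (fun x => ‖(G x).det‖ₑ * 2) ?_ ?_ ?_ ?_
      · exact fun j => hmG.enorm.mul (((hcχ j).measurable.sub (hχm.comp hpF)).enorm)
      · refine fun j => Eventually.of_forall fun x => ?_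
        beta_reduce
        gcongr
        refine enorm_sub_le.trans ((add_le_add (hχ _) (hχ _)).trans_eq one_add_one_eq_two)
      · rw [lintegral_mul_const _ hmG.enorm]
        exact ENNReal.mul_ne_top hintdet.2.ne (by simp)
      · refine Eventually.of_forall fun x => ?_
        have h3 : Tendsto (fun j => UnitAddTorus.mFourier m (proj n (Φ j x)) -
            UnitAddTorus.mFourier m (proj n (F x))) atTop (𝓝 0) := by
          have := ((((UnitAddTorus.mFourier m).continuous.comp (continuous_proj n)).tendsto
            (F x)).comp (hpt x)).sub_const (UnitAddTorus.mFourier m (proj n (F x)))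
          simpa using this
        have h4 := (continuous_enorm.tendsto (0 : ℂ)).comp h3
        rw [enorm_zero] at h4
        have h5 := ENNReal.Tendsto.const_mul (a := ‖(G x).det‖ₑ) h4 (Or.inr (by simp))
        rw [mul_zero] at h5
        exact h5
    have hsum : Tendsto (fun j => ∫⁻ x, ‖((fderiv ℝ (Φ j) x).det : ℂ) *
        UnitAddTorus.mFourier m (proj n (Φ j x)) -
          ((G x).det : ℂ) * UnitAddTorus.mFourier m (proj n (F x))‖ₑ ∂μ) atTop (𝓝 0) := by
      have h3 := hdetlim.add h2
      rw [add_zero] at h3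
      refine tendsto_of_tendsto_of_tendsto_of_le_of_le tendsto_const_nhds h3
        (fun _ => zero_le) fun j => ?_
      beta_reduce
      refine le_trans (lintegral_mono fun x => ?_)
        (lintegral_add_left (μ := μ)
          (f := fun x => ‖(fderiv ℝ (Φ j) x).det - (G x).det‖ₑ)
          ((hcΦ j).measurable.sub hmG).enorm _).le
      have hid : ((fderiv ℝ (Φ j) x).det : ℂ) * UnitAddTorus.mFourier m (proj n (Φ j x)) -
          ((G x).det : ℂ) * UnitAddTorus.mFourier m (proj n (F x)) =
          (((fderiv ℝ (Φ j) x).det - (G x).det : ℝ) : ℂ) *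
            UnitAddTorus.mFourier m (proj n (Φ j x)) + ((G x).det : ℂ) *
            (UnitAddTorus.mFourier m (proj n (Φ j x)) -
              UnitAddTorus.mFourier m (proj n (F x))) := by
        push_cast; ring
      have hof : ∀ r : ℝ, ‖(r : ℂ)‖ₑ = ‖r‖ₑ := fun r => by simp [← ofReal_norm]
      rw [hid]
      refine (enorm_add_le _ _).trans ?_
      rw [enorm_mul, enorm_mul, hof, hof]
      gcongr
      exact (mul_le_mul_right (hχ _) _).trans_eq (mul_one _)
    have hintF : Integrable (fun x => ((G x).det : ℂ) * UnitAddTorus.mFourier m (proj n (F x))) μ :=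
      (hintdet.ofReal (𝕜 := ℂ)).mul_bdd (c := 1) (hχm.comp hpF).aestronglyMeasurable
        (Eventually.of_forall fun x =>
          ((UnitAddTorus.mFourier m).norm_coe_le_norm _).trans_eq UnitAddTorus.mFourier_norm)
    have hlim := tendsto_integral_of_L1 _ hintF.1
      (Eventually.of_forall fun j =>
        hintcube ((Complex.continuous_ofReal.comp (hcΦ j)).mul (hcχ j)))
      hsum
    simp only [Function.comp_apply, Pi.mul_apply] at hlim
    have hconst : ∀ j, ∫ x, ((fderiv ℝ (Φ j) x).det : ℂ) *
        UnitAddTorus.mFourier m (proj n (Φ j x)) ∂μ =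
          ∫ x, UnitAddTorus.mFourier m (proj n x) ∂μ := fun j =>
      integral_mFourier_mul_det (hΦe j) (hΦd j) m
    simp only [hconst] at hlim
    exact tendsto_nhds_unique hlim tendsto_const_nhds
  have hdetμ : ∀ᵐ x ∂μ, 0 ≤ (G x).det := ae_restrict_of_ae hdet
  have hdm : Measurable fun x => ENNReal.ofReal (G x).det := hmG.ennreal_ofReal
  have hfinite : IsFiniteMeasure (μ.withDensity fun x => ENNReal.ofReal (G x).det) :=
    isFiniteMeasure_withDensity_ofReal hintdet.2
  have hmeas : Measure.map (fun x => proj n (F x))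
      (μ.withDensity fun x => ENNReal.ofReal (G x).det) = volume := by
    refine measure_ext_of_mFourier fun m => ?_
    have hχ : Continuous (UnitAddTorus.mFourier m : Torus n → ℂ) :=
      (UnitAddTorus.mFourier m).continuous
    rw [integral_map hpF.aemeasurable hχ.aestronglyMeasurable,
      integral_withDensity_eq_integral_toReal_smul hdm (Eventually.of_forall fun x => by simp),
      ← (measurePreserving_proj n).map_eq, integral_map (measurePreserving_proj n).aemeasurable
        hχ.aestronglyMeasurable, ← hchar m]
    refine integral_congr_ae ?_
    filter_upwards [hdetμ] with x hx
    rw [ENNReal.toReal_ofReal hx, Complex.real_smul]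
  rw [← lintegral_map hΨ (measurePreserving_proj n).measurable, (measurePreserving_proj n).map_eq,
    ← hmeas, lintegral_map hΨ hpF]
  exact (lintegral_withDensity_eq_lintegral_mul _ hdm (hΨ.comp hpF)).symm

/-! ### Sobolev limits and quasiconformal changes of variable -/

/-- The section of the covering projection with values in the unit cube. The two negations turn
`(-1, 0]` into `[0, 1)`. -/
def cubeSection (n : ℕ) (p : Torus n) : Euc n :=
  WithLp.toLp 2 fun i => -(AddCircle.measurableEquivIoc 1 (-1) (-p i) : ℝ)

lemma measurable_cubeSection (n : ℕ) : Measurable (cubeSection n) := by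
  refine (WithLp.measurable_toLp 2 _).comp (measurable_pi_iff.2 fun i => ?_)
  refine (measurable_subtype_coe.comp ?_).neg
  exact (AddCircle.measurableEquivIoc (1 : ℝ) (-1)).measurable.comp (measurable_pi_apply i).neg

lemma proj_cubeSection {n : ℕ} (p : Torus n) : proj n (cubeSection n p) = p := by
  ext i
  have h : (((AddCircle.measurableEquivIoc (1 : ℝ) (-1) (-p i) : ℝ)) : UnitAddCircle) = -p i :=
    (AddCircle.measurableEquivIoc (1 : ℝ) (-1)).symm_apply_apply (-p i)
  simp only [proj, cubeSection, AddCircle.coe_neg, h, neg_neg]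

/-- Points with the same projection differ by an integer vector. -/
lemma exists_eq_add_intVec {n : ℕ} {x y : Euc n} (h : proj n x = proj n y) :
    ∃ m : Fin n → ℤ, x = y + intVec m := by
  have h' : ∀ i, ∃ m : ℤ, x i = y i + m := fun i => by
    have h1 : ((x i - y i : ℝ) : UnitAddCircle) = 0 := by
      rw [AddCircle.coe_sub, sub_eq_zero]
      exact congrFun h i
    obtain ⟨m, hm⟩ := (AddCircle.coe_eq_zero_iff (1 : ℝ)).1 h1
    exact ⟨m, by simp only [zsmul_eq_mul, mul_one] at hm; linarith⟩
  choose m hm using h'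
  exact ⟨m, by ext i; simp [hm]⟩

lemma IsPeriodic.eq_of_proj_eq {n : ℕ} {X : Type*} {g : Euc n → X} (hg : IsPeriodic g)
    {x y : Euc n} (h : proj n x = proj n y) : g x = g y := by
  obtain ⟨m, rfl⟩ := exists_eq_add_intVec h
  exact hg y m

lemma proj_injOn_cube (n : ℕ) : InjOn (proj n) (cube n) := by
  intro x hx y hy h
  obtain ⟨m, hm⟩ := exists_eq_add_intVec h
  ext i
  have h0 : x i = y i + m i := by simp [hm]
  obtain ⟨hx0, hx1⟩ := hx i
  obtain ⟨hy0, hy1⟩ := hy i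
  have h1 : (m i : ℝ) < 1 := by linarith
  have h2 : (-1 : ℝ) < m i := by linarith
  have h3 : m i = 0 := by
    have : m i < 1 := by exact_mod_cast h1
    have : -1 < m i := by exact_mod_cast h2
    omega
  simp [h0, h3]

lemma cubeSection_mem_cube {n : ℕ} (p : Torus n) : cubeSection n p ∈ cube n := by
  intro i
  have h := (AddCircle.measurableEquivIoc (1 : ℝ) (-1) (-p i)).2
  simp only [cubeSection, mem_Ioc, mem_Ico] at h ⊢
  constructor <;> linarith

lemma cubeSection_proj {n : ℕ} {x : Euc n} (hx : x ∈ cube n) : cubeSection n (proj n x) = x :=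
  proj_injOn_cube n (cubeSection_mem_cube _) hx (proj_cubeSection _)

/-- `u` is a uniform limit of `C¹` functions `v`, with `v - xᵢ` periodic, whose differentials
converge in `Lⁿ` to `γ`; the differential `γ`, being periodic, is regarded as a function on the
torus. -/
def IsSobolevLimit {n : ℕ} (i : Fin n) (u : Euc n → ℝ) (γ : Torus n → Euc n →L[ℝ] ℝ) : Prop :=
  Measurable γ ∧ ∀ ε : ℝ, 0 < ε → ∃ v : Euc n → ℝ, ContDiff ℝ 1 v ∧
    (∀ (x : Euc n) (m : Fin n → ℤ), v (x + intVec m) = v x + m i) ∧ (∀ x, |v x - u x| ≤ ε) ∧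
    eLpNorm (fun x => fderiv ℝ v x - γ (proj n x)) n (volume.restrict (cube n)) ≤ ENNReal.ofReal ε

lemma isSobolevLimit_coordinate {n : ℕ} (i : Fin n) :
    IsSobolevLimit i (fun x => x i) fun _ => EuclideanSpace.proj i := by
  refine ⟨measurable_const, fun ε hε => ⟨fun x => x i, ?_, fun x m => by simp, fun x => by
    simpa using hε.le, ?_⟩⟩
  · exact (EuclideanSpace.proj i : Euc n →L[ℝ] ℝ).contDiff
  · have : ∀ x : Euc n, fderiv ℝ (fun x : Euc n => x i) x = EuclideanSpace.proj i := fun x =>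
      (EuclideanSpace.proj i : Euc n →L[ℝ] ℝ).fderiv
    simp only [this, sub_self]
    exact (eLpNorm_zero' (ε := Euc n →L[ℝ] ℝ)).trans_le zero_le

/-- Composition with a quasiconformal map preserves the Sobolev class, by the conformal invariance
of the `n`-energy: `‖A ∘ G‖ⁿ ≤ K ‖A‖ⁿ det G`, and the Jacobian is absorbed by the degree
formula. -/
lemma IsSobolevLimit.comp {n : ℕ} (hn : 1 ≤ n) {i : Fin n} {u : Euc n → ℝ}
    {γ : Torus n → Euc n →L[ℝ] ℝ} (hu : IsSobolevLimit i u γ) {f : Torus n → Torus n}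
    (hf : Measurable f) {F : Euc n → Euc n} {G : Euc n → Euc n →L[ℝ] Euc n}
    (hFf : ∀ x, proj n (F x) = f (proj n x)) (hF : Continuous F)
    (hFe : IsEquivariant F) (hG : Measurable G) (hw : HasWeakDifferential F G) (hL : LocallyLn G)
    (hdet : ∀ᵐ x, 0 ≤ (G x).det) {K : NNReal}
    (hK : ∀ᵐ x, ‖G x‖ₑ ^ n ≤ K * ENNReal.ofReal (G x).det) :
    IsSobolevLimit i (fun x => u (F x)) fun p => (γ (f p)).comp (G (cubeSection n p)) := by
  have hn0 : n ≠ 0 := by omega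
  have hn1 : (1 : ENNReal) ≤ n := by exact_mod_cast hn
  have hcomp : Measurable fun q : (Euc n →L[ℝ] ℝ) × (Euc n →L[ℝ] Euc n) => q.1.comp q.2 :=
    (isBoundedBilinearMap_comp (𝕜 := ℝ) (E := Euc n) (F := Euc n) (G := ℝ)).continuous.measurable
  obtain ⟨hγ, happ⟩ := hu
  refine ⟨hcomp.comp ((hγ.comp hf).prodMk (hG.comp (measurable_cubeSection n))), fun ε hε => ?_⟩
  set μ := (volume : Measure (Euc n)).restrict (cube n) with hμ
  have hGμ : eLpNorm G n μ ≠ ⊤ :=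
    ((eLpNorm_mono_measure _ (Measure.restrict_mono subset_closure le_rfl)).trans_lt
      (hL _ (bounded_cube n).isCompact_closure).2).ne
  set K₁ : NNReal := max K 1 with hK₁
  have hK₁pos : 0 < K₁ := lt_max_of_lt_right one_pos
  -- the approximation of `u` which is composed with mollifications of `F`
  obtain ⟨v, hvd, hve, hvu, hvL⟩ := happ (min (ε / 2) (ε / (3 * K₁)))
    (lt_min (half_pos hε) (by positivity))
  have hDc : Continuous (fderiv ℝ v) := hvd.continuous_fderiv one_ne_zero
  have hDp : IsPeriodic (fderiv ℝ v) := fun x m => by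
    have h1 : fderiv ℝ (fun y => v (y + intVec m)) x = fderiv ℝ v (x + intVec m) :=
      fderiv_comp_add_right _
    rw [← h1]
    simp only [hve]
    exact fderiv_add_const _
  obtain ⟨M, hM0, hM⟩ := hDp.exists_bound hDc
  have hDu := hDp.uniformContinuous hDc
  have hlip : LipschitzWith ⟨M, hM0⟩ v :=
    lipschitzWith_of_nnnorm_fderiv_le (hvd.differentiable one_ne_zero) fun x => hM x
  obtain ⟨Φ, hΦd, hΦe, hΦu, hΦL⟩ := exists_smooth_approx hn hF hFe hG hw hL
  have hpF : Measurable fun x => proj n (F x) := ((continuous_proj n).comp hF).measurable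
  have hε3 : 0 < ENNReal.ofReal (ε / 3) := ENNReal.ofReal_pos.2 (by positivity)
  -- the error made by replacing `γ` by the differential of `v`
  have hthird : eLpNorm (fun x => (fderiv ℝ v (F x) - γ (proj n (F x))).comp (G x)) n μ ≤
      ENNReal.ofReal (ε / 3) := by
    have hΨ : Measurable fun p => ‖fderiv ℝ v (cubeSection n p) - γ p‖ₑ ^ n :=
      ((hDc.measurable.comp (measurable_cubeSection n)).sub hγ).enorm.pow_const _
    have hΨp : ∀ y, ‖fderiv ℝ v (cubeSection n (proj n y)) - γ (proj n y)‖ₑ ^ n =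
        ‖fderiv ℝ v y - γ (proj n y)‖ₑ ^ n := fun y => by
      rw [hDp.eq_of_proj_eq (proj_cubeSection (proj n y))]
    have hdeg := lintegral_det_mul_comp hn hF hFe hG hw hL hdet hΨ
    simp only [hΨp] at hdeg
    have hpow : eLpNorm (fun x => (fderiv ℝ v (F x) - γ (proj n (F x))).comp (G x)) n μ ^ n ≤
        (K₁ * eLpNorm (fun x => fderiv ℝ v x - γ (proj n x)) n μ) ^ n := by
      rw [mul_pow, eLpNorm_natCast_pow hn0, eLpNorm_natCast_pow hn0, ← hdeg,
        ← lintegral_const_mul' _ _ (by simp)]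
      refine lintegral_mono_ae ?_
      filter_upwards [ae_restrict_of_ae hK] with x hx
      calc ‖(fderiv ℝ v (F x) - γ (proj n (F x))).comp (G x)‖ₑ ^ n
          ≤ (‖fderiv ℝ v (F x) - γ (proj n (F x))‖ₑ * ‖G x‖ₑ) ^ n := by
            gcongr
            exact ContinuousLinearMap.opENorm_comp_le _ _
        _ = ‖fderiv ℝ v (F x) - γ (proj n (F x))‖ₑ ^ n * ‖G x‖ₑ ^ n := mul_pow _ _ _
        _ ≤ ‖fderiv ℝ v (F x) - γ (proj n (F x))‖ₑ ^ n *
            (K₁ ^ n * ENNReal.ofReal (G x).det) := by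
            gcongr
            refine hx.trans ?_
            gcongr
            have : K ≤ K₁ ^ n := (le_max_left K 1).trans (le_self_pow₀ (le_max_right K 1) hn0)
            exact_mod_cast this
        _ = _ := by ring
    have hle := (ENNReal.pow_le_pow_left_iff hn0).1 hpow
    refine hle.trans ?_
    calc (K₁ : ENNReal) * eLpNorm (fun x => fderiv ℝ v x - γ (proj n x)) n μ
        ≤ K₁ * ENNReal.ofReal (ε / (3 * K₁)) := by
          gcongr
          exact hvL.trans (ENNReal.ofReal_le_ofReal (min_le_right _ _))
      _ = ENNReal.ofReal (ε / 3) := by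
          rw [← ENNReal.ofReal_coe_nnreal, ← ENNReal.ofReal_mul (by positivity)]
          congr 1
          field_simp
  -- the error made by mollifying `F` in the differential
  have hfirst : ∀ᶠ j in atTop,
      eLpNorm (fun x => (fderiv ℝ v (Φ j x)).comp (fderiv ℝ (Φ j) x - G x)) n μ ≤
        ENNReal.ofReal (ε / 3) := by
    have h1 : Tendsto (fun j => ENNReal.ofReal M *
        eLpNorm (fun x => fderiv ℝ (Φ j) x - G x) n μ) atTop (𝓝 0) := by
      simpa using ENNReal.Tendsto.const_mul (a := ENNReal.ofReal M) hΦL (Or.inr (by simp))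
    filter_upwards [ENNReal.tendsto_nhds_zero.1 h1 _ hε3] with j hj
    refine le_trans ?_ hj
    refine eLpNorm_le_mul_eLpNorm_of_ae_le_mul (Eventually.of_forall fun x => ?_) _
    refine (ContinuousLinearMap.opNorm_comp_le _ _).trans ?_
    gcongr
    exact hM _
  -- the error made by mollifying `F` in the base point
  have hsecond : ∀ᶠ j in atTop,
      eLpNorm (fun x => (fderiv ℝ v (Φ j x) - fderiv ℝ v (F x)).comp (G x)) n μ ≤
        ENNReal.ofReal (ε / 3) := by
    set T := (eLpNorm G n μ).toReal with hT
    have hT0 : 0 ≤ T := ENNReal.toReal_nonneg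
    obtain ⟨δ, hδ, hδu⟩ := Metric.uniformContinuous_iff.1 hDu (ε / 3 / (T + 1)) (by positivity)
    filter_upwards [hΦu (δ / 2) (half_pos hδ)] with j hj
    refine (eLpNorm_le_mul_eLpNorm_of_ae_le_mul (g := G) (c := ε / 3 / (T + 1))
      (Eventually.of_forall fun x => ?_) _).trans ?_
    · refine (ContinuousLinearMap.opNorm_comp_le _ _).trans ?_
      gcongr
      rw [← dist_eq_norm]
      refine (hδu ?_).le
      rw [dist_eq_norm]
      exact (hj x).trans_lt (half_lt_self hδ)
    · rw [← ENNReal.ofReal_toReal hGμ, ← ENNReal.ofReal_mul (by positivity)]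
      refine ENNReal.ofReal_le_ofReal ?_
      rw [div_mul_eq_mul_div, div_le_iff₀ (by positivity)]
      gcongr
      linarith
  have hunif : ∀ᶠ j in atTop, ∀ x, |v (Φ j x) - v (F x)| ≤ ε / 2 := by
    filter_upwards [hΦu (ε / 2 / (M + 1)) (by positivity)] with j hj x
    rw [← Real.norm_eq_abs]
    refine (hlip.norm_sub_le _ _).trans ?_
    calc M * ‖Φ j x - F x‖ ≤ (M + 1) * (ε / 2 / (M + 1)) := by
          gcongr
          · linarith
          · exact hj x
      _ = ε / 2 := by field_simp
  obtain ⟨j, hj1, hj2, hj3⟩ := (hfirst.and (hsecond.and hunif)).exists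
  refine ⟨fun x => v (Φ j x), hvd.comp (hΦd j), fun x m => by simp only [hΦe j x m, hve],
    fun x => ?_, ?_⟩
  · calc |v (Φ j x) - u (F x)| ≤ |v (Φ j x) - v (F x)| + |v (F x) - u (F x)| := abs_sub_le _ _ _
      _ ≤ ε / 2 + ε / 2 := add_le_add (hj3 x) ((hvu _).trans (min_le_left _ _))
      _ = ε := add_halves ε
  · have hdecomp : ∀ x ∈ cube n, fderiv ℝ (fun x => v (Φ j x)) x -
        (γ (f (proj n x))).comp (G (cubeSection n (proj n x))) =
        ((fderiv ℝ v (Φ j x)).comp (fderiv ℝ (Φ j) x - G x) +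
          (fderiv ℝ v (Φ j x) - fderiv ℝ v (F x)).comp (G x)) +
          (fderiv ℝ v (F x) - γ (proj n (F x))).comp (G x) := by
      intro x hx
      have h1 : fderiv ℝ (fun x => v (Φ j x)) x = (fderiv ℝ v (Φ j x)).comp (fderiv ℝ (Φ j) x) :=
        fderiv_comp x (hvd.differentiable one_ne_zero _) ((hΦd j).differentiable one_ne_zero x)
      rw [h1, cubeSection_proj hx, ← hFf]
      simp only [ContinuousLinearMap.comp_sub, ContinuousLinearMap.sub_comp]
      abel
    rw [eLpNorm_congr_ae ((ae_restrict_iff' (measurable_cube n)).2 (Eventually.of_forall hdecomp))]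
    have hDm : ∀ {g : Euc n → Euc n}, Continuous g → Measurable fun x => fderiv ℝ v (g x) :=
      fun hg => (hDc.comp hg).measurable
    have m1 : Measurable fun x => (fderiv ℝ v (Φ j x)).comp (fderiv ℝ (Φ j) x - G x) :=
      hcomp.comp ((hDm (hΦd j).continuous).prodMk
        (((hΦd j).continuous_fderiv one_ne_zero).measurable.sub hG))
    have m2 : Measurable fun x => (fderiv ℝ v (Φ j x) - fderiv ℝ v (F x)).comp (G x) :=
      hcomp.comp (((hDm (hΦd j).continuous).sub (hDm hF)).prodMk hG)
    have m3 : Measurable fun x => (fderiv ℝ v (F x) - γ (proj n (F x))).comp (G x) :=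
      hcomp.comp (((hDm hF).sub (hγ.comp hpF)).prodMk hG)
    calc _ ≤ _ := eLpNorm_add_le (m1.add m2).aestronglyMeasurable m3.aestronglyMeasurable hn1
      _ ≤ (ENNReal.ofReal (ε / 3) + ENNReal.ofReal (ε / 3)) + ENNReal.ofReal (ε / 3) :=
        add_le_add ((eLpNorm_add_le m1.aestronglyMeasurable m2.aestronglyMeasurable hn1).trans
          (add_le_add hj1 hj2)) hthird
      _ = ENNReal.ofReal ε := by
        rw [← ENNReal.ofReal_add (by positivity) (by positivity),
          ← ENNReal.ofReal_add (by positivity) (by positivity)]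
        congr 1; ring

/-! ### The crossing inequality for smooth functions -/

/-- The part of an interval of length one which projects to a ball of the circle. -/
lemma volume_Ico_inter_ball_le (a r : ℝ) (c : UnitAddCircle) :
    volume (Ico a (a + 1) ∩ {t : ℝ | ‖(t : UnitAddCircle) - c‖ ≤ r}) ≤ ENNReal.ofReal (2 * r) := by
  have h1 := (UnitAddCircle.measurePreserving_mk a).measure_preimage
    (Metric.isClosed_closedBall (x := c) (ε := r)).measurableSet.nullMeasurableSet
  rw [AddCircle.volume_closedBall, ← Measure.restrict_congr_set Ico_ae_eq_Ioc,
    Measure.restrict_apply' measurableSet_Ico, inter_comm] at h1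
  have h2 : {t : ℝ | ‖(t : UnitAddCircle) - c‖ ≤ r} =
      QuotientAddGroup.mk ⁻¹' Metric.closedBall c r := by
    ext t
    simp only [mem_ofPred_eq, mem_preimage, Metric.mem_closedBall, dist_eq_norm]
  rw [h2, h1]
  exact ENNReal.ofReal_le_ofReal (min_le_right _ _)

/-- A path of displacement one in the line, projected to the circle, covers it: the lengths of the
arcs which contain the images of the sets `S p`, and the length of the image of the remaining set
`N`, add up to at least one. -/
lemma one_le_sum_add_lintegral_deriv {ι : Type*} {w : ℝ → ℝ} (hw : ContDiff ℝ 1 w)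
    (hw1 : w 1 = w 0 + 1) (P : Finset ι) (S : ι → Set ℝ) (c : ι → UnitAddCircle) (r : ι → ℝ)
    (hr : ∀ p ∈ P, ∀ s ∈ S p, ‖((w s : ℝ) : UnitAddCircle) - c p‖ ≤ r p) {N : Set ℝ}
    (hN : MeasurableSet N) (hcover : ∀ s ∈ Ico (0 : ℝ) 1, s ∈ N ∨ ∃ p ∈ P, s ∈ S p) :
    1 ≤ ∑ p ∈ P, ENNReal.ofReal (2 * r p) + ∫⁻ s in N, ‖deriv w s‖ₑ := by
  have hdiff : Differentiable ℝ w := hw.differentiable one_ne_zero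
  have hsub : Ico (w 0) (w 0 + 1) ⊆
      (⋃ p ∈ P, Ico (w 0) (w 0 + 1) ∩ {t : ℝ | ‖(t : UnitAddCircle) - c p‖ ≤ r p}) ∪ w '' N := by
    intro t ht
    obtain ⟨s, hs, rfl⟩ := intermediate_value_Icc zero_le_one hw.continuous.continuousOn
      (show t ∈ Icc (w 0) (w 1) from ⟨ht.1, by rw [hw1]; exact ht.2.le⟩)
    have hs1 : s ≠ 1 := by
      rintro rfl
      rw [hw1] at ht
      exact lt_irrefl _ ht.2
    rcases hcover s ⟨hs.1, lt_of_le_of_ne hs.2 hs1⟩ with h | ⟨p, hp, h⟩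
    · exact Or.inr ⟨s, h, rfl⟩
    · exact Or.inl (mem_iUnion₂.2 ⟨p, hp, ht, hr p hp s h⟩)
  have himage : volume (w '' N) ≤ ∫⁻ s in N, ‖deriv w s‖ₑ := by
    have := addHaar_image_le_lintegral_abs_det_fderiv volume hN
      (fun s _ => (hdiff s).hasFDerivAt.hasFDerivWithinAt)
    refine this.trans_eq (lintegral_congr fun s => ?_)
    rw [← Real.enorm_eq_ofReal_abs]
    congr 1
    have h : fderiv ℝ w s = ContinuousLinearMap.toSpanSingleton ℝ (deriv w s) := by
      ext; simp
    rw [h]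
    simp
  have hvol : volume (Ico (w 0) (w 0 + 1)) = 1 := by simp
  rw [← hvol]
  refine (measure_mono hsub).trans ((measure_union_le _ _).trans (add_le_add ?_ himage))
  exact (measure_biUnion_finset_le _ _).trans
    (Finset.sum_le_sum fun p _ => volume_Ico_inter_ball_le _ _ _)

/-- The point of `ℝᵈ⁺¹` with first coordinate `s` and other coordinates `y`. -/
def consPoint {d : ℕ} (s : ℝ) (y : Fin d → ℝ) : Euc (d + 1) :=
  WithLp.toLp 2 (Fin.cons s y : Fin (d + 1) → ℝ)

@[simp] lemma consPoint_zero {d : ℕ} (s : ℝ) (y : Fin d → ℝ) : consPoint s y 0 = s := rfl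

@[simp] lemma consPoint_succ {d : ℕ} (s : ℝ) (y : Fin d → ℝ) (j : Fin d) :
    consPoint s y j.succ = y j := rfl

lemma proj_consPoint_succ {d : ℕ} (s : ℝ) (y : Fin d → ℝ) (j : Fin d) :
    proj (d + 1) (consPoint s y) j.succ = (y j : UnitAddCircle) := by
  simp only [proj, consPoint_succ]

lemma measurable_consPoint {d : ℕ} :
    Measurable fun z : ℝ × (Fin d → ℝ) => (consPoint z.1 z.2 : Euc (d + 1)) := by
  refine (WithLp.measurable_toLp 2 _).comp (measurable_pi_iff.2 fun i => ?_)
  refine Fin.cases ?_ (fun j => ?_) i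
  · exact measurable_fst
  · exact (measurable_pi_apply j).comp measurable_snd

/-- Integration over the unit cube along the lines parallel to the first axis. -/
lemma lintegral_cube_eq {d : ℕ} {g : Euc (d + 1) → ENNReal} (hg : Measurable g) :
    ∫⁻ x in cube (d + 1), g x =
      ∫⁻ y in univ.pi fun _ : Fin d => Ico (0 : ℝ) 1, ∫⁻ s in Ico (0 : ℝ) 1, g (consPoint s y) := by
  have hmp : MeasurePreserving (fun z : ℝ × (Fin d → ℝ) => (consPoint z.1 z.2 : Euc (d + 1)))
      (volume.prod volume) volume := by
    have h1 := (volume_preserving_piFinSuccAbove (fun _ : Fin (d + 1) => ℝ) 0).symm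
    have h2 := (PiLp.volume_preserving_toLp (Fin (d + 1))).comp h1
    have h3 : (fun z : ℝ × (Fin d → ℝ) => (consPoint z.1 z.2 : Euc (d + 1))) =
        WithLp.toLp 2 ∘ (MeasurableEquiv.piFinSuccAbove (fun _ : Fin (d + 1) => ℝ) 0).symm := by
      funext z
      simp [consPoint, MeasurableEquiv.piFinSuccAbove]
      rfl
    rw [h3]
    exact h2
  have hpre := hmp.restrict_preimage (measurable_cube (d + 1))
  have hset : (fun z : ℝ × (Fin d → ℝ) => (consPoint z.1 z.2 : Euc (d + 1))) ⁻¹' cube (d + 1) =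
      Ico (0 : ℝ) 1 ×ˢ univ.pi fun _ : Fin d => Ico (0 : ℝ) 1 := by
    ext z
    simp only [mem_preimage, cube, mem_ofPred_eq, Fin.forall_fin_succ, consPoint_zero,
      consPoint_succ, mem_prod, mem_univ_pi]
  rw [hset, ← Measure.prod_restrict] at hpre
  rw [← hpre.lintegral_comp hg,
    lintegral_prod_symm' (fun z : ℝ × (Fin d → ℝ) => g (consPoint z.1 z.2))
      (hg.comp measurable_consPoint)]

lemma norm_sub_le_flatDist {n : ℕ} (p q : Torus n) (i : Fin n) : ‖p i - q i‖ ≤ flatDist p q := by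
  refine Real.le_sqrt_of_sq_le ?_
  exact Finset.single_le_sum (f := fun i => ‖p i - q i‖ ^ 2) (fun _ _ => sq_nonneg _)
    (Finset.mem_univ i)

/-- The lines parallel to the first axis which meet a given ball of the torus form a set of measure
at most the volume of a cube of dimension `d` and of the same diameter. -/
lemma volume_lines_le {d : ℕ} (c : Fin d → UnitAddCircle) (ρ : ℝ) :
    volume ((univ.pi fun _ : Fin d => Ico (0 : ℝ) 1) ∩
      {y : Fin d → ℝ | ∀ j, ‖(y j : UnitAddCircle) - c j‖ ≤ ρ}) ≤ ENNReal.ofReal (2 * ρ) ^ d := by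
  have h : (univ.pi fun _ : Fin d => Ico (0 : ℝ) 1) ∩
      {y : Fin d → ℝ | ∀ j, ‖(y j : UnitAddCircle) - c j‖ ≤ ρ} =
      univ.pi fun j => Ico (0 : ℝ) (0 + 1) ∩ {t : ℝ | ‖(t : UnitAddCircle) - c j‖ ≤ ρ} := by
    ext y
    simp only [mem_inter_iff, mem_univ_pi, mem_ofPred_eq, zero_add, forall_and]
  rw [h, volume_pi_pi]
  refine (Finset.prod_le_prod' fun j _ => volume_Ico_inter_ball_le 0 ρ (c j)).trans_eq ?_
  simp

/-- The derivative along a line parallel to the first axis. -/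
lemma hasDerivAt_comp_consPoint {d : ℕ} {v : Euc (d + 1) → ℝ} (hv : Differentiable ℝ v)
    (y : Fin d → ℝ) (s : ℝ) :
    HasDerivAt (fun s : ℝ => v (consPoint s y))
      (fderiv ℝ v (consPoint s y) (EuclideanSpace.single 0 1)) s := by
  have haff : (fun s : ℝ => (consPoint s y : Euc (d + 1))) =
      fun s => consPoint 0 y + s • EuclideanSpace.single 0 1 := by
    funext s
    ext i
    refine Fin.cases ?_ (fun j => ?_) i <;> simp
  have h1 : HasDerivAt (fun s : ℝ => (consPoint s y : Euc (d + 1)))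
      (EuclideanSpace.single 0 1) s := by
    rw [haff]
    simpa using ((hasDerivAt_id s).smul_const
      (EuclideanSpace.single (0 : Fin (d + 1)) (1 : ℝ))).const_add (consPoint 0 y)
  exact ((hv (consPoint s y)).hasFDerivAt).comp_hasDerivAt s h1

lemma contDiff_consPoint {d : ℕ} (y : Fin d → ℝ) :
    ContDiff ℝ 1 fun s : ℝ => (consPoint s y : Euc (d + 1)) := by
  have haff : (fun s : ℝ => (consPoint s y : Euc (d + 1))) =
      fun s => consPoint 0 y + s • EuclideanSpace.single 0 1 := by
    funext s
    ext i
    refine Fin.cases ?_ (fun j => ?_) i <;> simp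
  rw [haff]
  fun_prop

/-- The lines parallel to the first axis, given by their other coordinates, which may meet the ball
of centre `c` and radius `ρ`. -/
def lineBox {d : ℕ} (c : Torus (d + 1)) (ρ : ℝ) : Set (Fin d → ℝ) :=
  {y | ∀ j : Fin d, ‖(y j : UnitAddCircle) - c j.succ‖ ≤ ρ}

lemma measurableSet_lineBox {d : ℕ} (c : Torus (d + 1)) (ρ : ℝ) :
    MeasurableSet (lineBox c ρ) := by
  have : IsClosed (lineBox c ρ) := by
    simp only [lineBox, ofPred_forall]
    refine isClosed_iInter fun j => isClosed_le ?_ continuous_const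
    exact (((AddCircle.continuous_mk' (1 : ℝ)).comp (continuous_apply j)).sub
      continuous_const).norm
  exact this.measurableSet

/-- The crossing inequality on one line parallel to the first axis: the line projects to a closed
curve which `v` maps onto the circle, and which is covered by the sets `D p` that it meets and by
`N`. -/
lemma one_le_sum_add_lintegral_line {d : ℕ} {ι : Type*} {v : Euc (d + 1) → ℝ}
    (hv : ContDiff ℝ 1 v)
    (hve : ∀ (x : Euc (d + 1)) (m : Fin (d + 1) → ℤ), v (x + intVec m) = v x + m 0)
    (P : Finset ι) (D : ι → Set (Torus (d + 1))) (c : ι → Torus (d + 1)) (ρ : ι → ℝ)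
    (hD : ∀ p ∈ P, ∀ q ∈ D p, flatDist q (c p) ≤ ρ p) (c' : ι → UnitAddCircle) (r : ι → ℝ)
    (hr : ∀ p ∈ P, ∀ x, proj (d + 1) x ∈ D p → ‖((v x : ℝ) : UnitAddCircle) - c' p‖ ≤ r p)
    {N : Set (Torus (d + 1))} (hN : MeasurableSet N) (hcover : ∀ q, q ∈ N ∨ ∃ p ∈ P, q ∈ D p)
    (y : Fin d → ℝ) :
    1 ≤ ∑ p ∈ P, (lineBox (c p) (ρ p)).indicator (fun _ => ENNReal.ofReal (2 * r p)) y +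
      ∫⁻ s in Ico (0 : ℝ) 1,
        (proj (d + 1) ⁻¹' N).indicator (fun x => ‖fderiv ℝ v x‖ₑ) (consPoint s y) := by
  classical
  have h01 : v (consPoint 1 y) = v (consPoint 0 y) + 1 := by
    have : (consPoint 1 y : Euc (d + 1)) =
        consPoint 0 y + intVec (Pi.single 0 1 : Fin (d + 1) → ℤ) := by
      ext i
      refine Fin.cases ?_ (fun j => ?_) i <;> simp
    rw [this, hve]
    simp
  set L : Set ℝ := {s | proj (d + 1) (consPoint s y) ∈ N} with hL
  have hLm : MeasurableSet L :=
    ((continuous_proj _).comp (contDiff_consPoint y).continuous).measurable hN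
  have h := one_le_sum_add_lintegral_deriv (w := fun s => v (consPoint s y))
    (hv.comp (contDiff_consPoint y)) h01
    (P.filter fun p => y ∈ lineBox (c p) (ρ p))
    (fun p => {s | proj (d + 1) (consPoint s y) ∈ D p}) c' r
    (fun p hp s hs => hr p (Finset.mem_filter.1 hp).1 _ hs)
    (hLm.inter (measurableSet_Ico (a := (0 : ℝ)) (b := 1))) ?_
  · refine h.trans (add_le_add ?_ ?_)
    · rw [Finset.sum_filter]
      exact Finset.sum_le_sum fun p _ => by simp [indicator_apply]
    · rw [← Measure.restrict_restrict hLm, ← lintegral_indicator hLm]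
      refine lintegral_mono fun s => ?_
      by_cases hs : s ∈ L
      · have hs' : consPoint s y ∈ proj (d + 1) ⁻¹' N := hs
        rw [indicator_of_mem hs, indicator_of_mem hs',
          (hasDerivAt_comp_consPoint (hv.differentiable one_ne_zero) y s).deriv]
        have h1 := (fderiv ℝ v (consPoint s y)).le_opNorm (EuclideanSpace.single 0 1)
        rw [PiLp.norm_single, norm_one, mul_one] at h1
        rw [← ofReal_norm, ← ofReal_norm]
        exact ENNReal.ofReal_le_ofReal h1
      · rw [indicator_of_notMem hs]
        exact zero_le
  · intro s hs
    rcases hcover (proj (d + 1) (consPoint s y)) with h | ⟨p, hp, h⟩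
    · exact Or.inl ⟨h, hs⟩
    · refine Or.inr ⟨p, Finset.mem_filter.2 ⟨hp, fun j => ?_⟩, h⟩
      rw [← proj_consPoint_succ s y j]
      exact (norm_sub_le_flatDist _ _ j.succ).trans (hD p hp _ h)

/-- The crossing inequality, integrated over all lines parallel to the first axis: the set of lines
which meet `D p` has measure at most `(2 ρ p)ᵈ`. -/
lemma one_le_sum_add_lintegral_fderiv {d : ℕ} {ι : Type*} {v : Euc (d + 1) → ℝ}
    (hv : ContDiff ℝ 1 v)
    (hve : ∀ (x : Euc (d + 1)) (m : Fin (d + 1) → ℤ), v (x + intVec m) = v x + m 0)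
    (P : Finset ι) (D : ι → Set (Torus (d + 1))) (c : ι → Torus (d + 1)) (ρ : ι → ℝ)
    (hD : ∀ p ∈ P, ∀ q ∈ D p, flatDist q (c p) ≤ ρ p) (c' : ι → UnitAddCircle) (r : ι → ℝ)
    (hr : ∀ p ∈ P, ∀ x, proj (d + 1) x ∈ D p → ‖((v x : ℝ) : UnitAddCircle) - c' p‖ ≤ r p)
    {N : Set (Torus (d + 1))} (hN : MeasurableSet N) (hcover : ∀ q, q ∈ N ∨ ∃ p ∈ P, q ∈ D p) :
    1 ≤ ∑ p ∈ P, ENNReal.ofReal (2 * r p) * ENNReal.ofReal (2 * ρ p) ^ d +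
      ∫⁻ x in cube (d + 1), (proj (d + 1) ⁻¹' N).indicator (fun x => ‖fderiv ℝ v x‖ₑ) x := by
  have hNm : MeasurableSet (proj (d + 1) ⁻¹' N) := (continuous_proj _).measurable hN
  have hgm : Measurable ((proj (d + 1) ⁻¹' N).indicator fun x => ‖fderiv ℝ v x‖ₑ) :=
    (hv.continuous_fderiv one_ne_zero).measurable.enorm.indicator hNm
  have hind : ∀ p ∈ P, Measurable
      ((lineBox (c p) (ρ p)).indicator fun _ => ENNReal.ofReal (2 * r p)) := fun p _ =>
    measurable_const.indicator (measurableSet_lineBox _ _)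
  have hvol : volume (univ.pi fun _ : Fin d => Ico (0 : ℝ) 1) = 1 := by
    rw [volume_pi_pi]; simp
  have h1 : (1 : ENNReal) ≤ ∫⁻ y in univ.pi fun _ : Fin d => Ico (0 : ℝ) 1, (∑ p ∈ P,
      (lineBox (c p) (ρ p)).indicator (fun _ => ENNReal.ofReal (2 * r p)) y +
        ∫⁻ s in Ico (0 : ℝ) 1,
          (proj (d + 1) ⁻¹' N).indicator (fun x => ‖fderiv ℝ v x‖ₑ) (consPoint s y)) := by
    calc (1 : ENNReal) = ∫⁻ _ in univ.pi fun _ : Fin d => Ico (0 : ℝ) 1, 1 := by simp [hvol]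
      _ ≤ _ := lintegral_mono fun y =>
        one_le_sum_add_lintegral_line hv hve P D c ρ hD c' r hr hN hcover y
  rw [lintegral_add_left (Finset.measurable_fun_sum _ hind), lintegral_finsetSum _ hind,
    ← lintegral_cube_eq hgm] at h1
  refine h1.trans (add_le_add (Finset.sum_le_sum fun p _ => ?_) le_rfl)
  rw [lintegral_indicator_const (measurableSet_lineBox _ _),
    Measure.restrict_apply (measurableSet_lineBox _ _), inter_comm]
  gcongr
  exact volume_lines_le _ _

/-! ### The crossing inequality in the limit, and decorrelation -/

lemma IsSobolevLimit.lintegral_ne_top {n : ℕ} (hn : 1 ≤ n) {i : Fin n} {u : Euc n → ℝ}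
    {γ : Torus n → Euc n →L[ℝ] ℝ} (hu : IsSobolevLimit i u γ) :
    ∫⁻ q, ‖γ q‖ₑ ≠ ⊤ := by
  obtain ⟨v, hv, -, -, hL⟩ := hu.2 1 one_pos
  have hc : Continuous (fderiv ℝ v) := hv.continuous_fderiv one_ne_zero
  have hm : Measurable fun x => fderiv ℝ v x - γ (proj n x) :=
    hc.measurable.sub (hu.1.comp (continuous_proj n).measurable)
  have h1 : ∫⁻ x in cube n, ‖fderiv ℝ v x‖ₑ ≠ ⊤ :=
    ((hc.locallyIntegrable.integrableOn_isCompact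
      (bounded_cube n).isCompact_closure).mono_set subset_closure).2.ne
  have h2 : ∫⁻ x in cube n, ‖fderiv ℝ v x - γ (proj n x)‖ₑ ≤ 1 := by
    rw [← eLpNorm_one_eq_lintegral_enorm]
    refine (eLpNorm_le_eLpNorm_of_exponent_le (by exact_mod_cast hn) hm.aestronglyMeasurable).trans
      (hL.trans_eq ENNReal.ofReal_one)
  rw [← (measurePreserving_proj n).lintegral_comp hu.1.enorm]
  refine ne_of_lt ?_
  calc ∫⁻ x in cube n, ‖γ (proj n x)‖ₑ
      ≤ ∫⁻ x in cube n, (‖fderiv ℝ v x‖ₑ + ‖fderiv ℝ v x - γ (proj n x)‖ₑ) := by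
        refine lintegral_mono fun x => ?_
        simpa using enorm_sub_le (a := fderiv ℝ v x) (b := fderiv ℝ v x - γ (proj n x))
    _ = _ := lintegral_add_left hc.measurable.enorm _
    _ < ⊤ := ENNReal.add_lt_top.2 ⟨h1.lt_top, h2.trans_lt ENNReal.one_lt_top⟩

/-- The crossing inequality for a Sobolev function and finitely many domains. -/
lemma IsSobolevLimit.one_le_sum_add {d : ℕ} {ι : Type*} {u : Euc (d + 1) → ℝ}
    {γ : Torus (d + 1) → Euc (d + 1) →L[ℝ] ℝ} (hu : IsSobolevLimit 0 u γ)
    (P : Finset ι) (D : ι → Set (Torus (d + 1))) (c : ι → Torus (d + 1)) (ρ : ι → ℝ)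
    (hD : ∀ p ∈ P, ∀ q ∈ D p, flatDist q (c p) ≤ ρ p) (c' : ι → UnitAddCircle) (r : ι → ℝ)
    (hr0 : ∀ p, 0 ≤ r p)
    (hr : ∀ p ∈ P, ∀ x, proj (d + 1) x ∈ D p → ‖((u x : ℝ) : UnitAddCircle) - c' p‖ ≤ r p)
    {N : Set (Torus (d + 1))} (hN : MeasurableSet N) (hcover : ∀ q, q ∈ N ∨ ∃ p ∈ P, q ∈ D p) :
    1 ≤ ∑ p ∈ P, ENNReal.ofReal (2 * r p) * ENNReal.ofReal (2 * ρ p) ^ d +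
      ∫⁻ q in N, ‖γ q‖ₑ := by
  have hNm : MeasurableSet (proj (d + 1) ⁻¹' N) := (continuous_proj _).measurable hN
  set Q : ENNReal := ∑ p ∈ P, ENNReal.ofReal (2 * ρ p) ^ d with hQ
  have hQt : Q ≠ ⊤ := ENNReal.sum_ne_top.2 fun p _ => ENNReal.pow_ne_top ENNReal.ofReal_ne_top
  set A : ENNReal := ∑ p ∈ P, ENNReal.ofReal (2 * r p) * ENNReal.ofReal (2 * ρ p) ^ d +
      ∫⁻ q in N, ‖γ q‖ₑ with hA
  have hstep : ∀ ε : ℝ, 0 < ε → 1 ≤ A + ENNReal.ofReal ε * (2 * Q + 1) := by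
    intro ε hε
    obtain ⟨v, hv, hve, hvu, hvL⟩ := hu.2 ε hε
    have hrv : ∀ p ∈ P, ∀ x, proj (d + 1) x ∈ D p →
        ‖((v x : ℝ) : UnitAddCircle) - c' p‖ ≤ r p + ε := by
      intro p hp x hx
      have h1 : ‖((v x : ℝ) : UnitAddCircle) - ((u x : ℝ) : UnitAddCircle)‖ ≤ ε := by
        rw [← AddCircle.coe_sub]
        exact (QuotientAddGroup.norm_mk_le_norm (m := v x - u x)).trans (hvu x)
      calc _ = ‖(((v x : ℝ) : UnitAddCircle) - ((u x : ℝ) : UnitAddCircle)) +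
            (((u x : ℝ) : UnitAddCircle) - c' p)‖ := by rw [sub_add_sub_cancel]
        _ ≤ ε + r p := (norm_add_le _ _).trans (add_le_add h1 (hr p hp x hx))
        _ = r p + ε := add_comm _ _
    have h := one_le_sum_add_lintegral_fderiv hv hve P D c ρ hD c' (fun p => r p + ε) hrv hN hcover
    have hDm : Measurable fun x => fderiv ℝ v x - γ (proj (d + 1) x) :=
      (hv.continuous_fderiv one_ne_zero).measurable.sub (hu.1.comp (continuous_proj _).measurable)
    have hint : ∫⁻ x in cube (d + 1),
        (proj (d + 1) ⁻¹' N).indicator (fun x => ‖fderiv ℝ v x‖ₑ) x ≤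
          (∫⁻ q in N, ‖γ q‖ₑ) + ENNReal.ofReal ε := by
      calc _ ≤ ∫⁻ x in cube (d + 1), (N.indicator (fun q => ‖γ q‖ₑ) (proj (d + 1) x) +
            ‖fderiv ℝ v x - γ (proj (d + 1) x)‖ₑ) := by
            refine lintegral_mono fun x => ?_
            by_cases hx : proj (d + 1) x ∈ N
            · have hx' : x ∈ proj (d + 1) ⁻¹' N := hx
              rw [indicator_of_mem hx, indicator_of_mem hx', add_comm (‖γ _‖ₑ)]
              simpa using enorm_add_le (fderiv ℝ v x - γ (proj (d + 1) x)) (γ (proj (d + 1) x))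
            · have hx' : x ∉ proj (d + 1) ⁻¹' N := hx
              rw [indicator_of_notMem hx']
              exact zero_le
        _ = (∫⁻ q in N, ‖γ q‖ₑ) +
            ∫⁻ x in cube (d + 1), ‖fderiv ℝ v x - γ (proj (d + 1) x)‖ₑ := by
            rw [lintegral_add_right _ hDm.enorm,
              (measurePreserving_proj (d + 1)).lintegral_comp (hu.1.enorm.indicator hN),
              lintegral_indicator hN]
        _ ≤ _ := by
            gcongr
            rw [← eLpNorm_one_eq_lintegral_enorm]
            exact (eLpNorm_le_eLpNorm_of_exponent_le (by exact_mod_cast d.succ_pos)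
              hDm.aestronglyMeasurable).trans hvL
    calc (1 : ENNReal) ≤ _ := h
      _ ≤ ∑ p ∈ P, (ENNReal.ofReal (2 * r p) * ENNReal.ofReal (2 * ρ p) ^ d +
          2 * ENNReal.ofReal ε * ENNReal.ofReal (2 * ρ p) ^ d) +
          ((∫⁻ q in N, ‖γ q‖ₑ) + ENNReal.ofReal ε) := by
          refine add_le_add (Finset.sum_le_sum fun p _ => le_of_eq ?_) hint
          rw [mul_add, ENNReal.ofReal_add (mul_nonneg zero_le_two (hr0 p)) (by positivity), add_mul,
            ENNReal.ofReal_mul zero_le_two (q := ε), ENNReal.ofReal_ofNat]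
      _ = _ := by
          rw [Finset.sum_add_distrib, ← Finset.mul_sum, hA, hQ]
          ring
  refine ENNReal.le_of_forall_pos_le_add fun η hη _ => ?_
  have hQt' : 2 * Q + 1 ≠ ⊤ :=
    ENNReal.add_ne_top.2 ⟨ENNReal.mul_ne_top (by simp) hQt, ENNReal.one_ne_top⟩
  obtain ⟨ε, hε0, hε⟩ := ENNReal.exists_nnreal_pos_mul_lt hQt'
    (show (η : ENNReal) ≠ 0 by exact_mod_cast hη.ne')
  refine (hstep ε (by exact_mod_cast hε0)).trans ?_
  gcongr
  rw [ENNReal.ofReal_coe_nnreal]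
  exact hε.le

/-- The crossing inequality for a Sobolev function and countably many disjoint domains which fill
the torus up to a null set. -/
lemma IsSobolevLimit.one_le_tsum {d : ℕ} {ι : Type*} [Countable ι] {u : Euc (d + 1) → ℝ}
    {γ : Torus (d + 1) → Euc (d + 1) →L[ℝ] ℝ} (hu : IsSobolevLimit 0 u γ)
    (D : ι → Set (Torus (d + 1))) (hDm : ∀ p, MeasurableSet (D p))
    (hdisj : Pairwise (Function.onFun Disjoint D)) (hnull : volume (⋃ p, D p)ᶜ = 0)
    (c : ι → Torus (d + 1)) (ρ : ι → ℝ)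
    (hD : ∀ p, ∀ q ∈ D p, flatDist q (c p) ≤ ρ p) (c' : ι → UnitAddCircle) (r : ι → ℝ)
    (hr0 : ∀ p, 0 ≤ r p)
    (hr : ∀ p, ∀ x, proj (d + 1) x ∈ D p → ‖((u x : ℝ) : UnitAddCircle) - c' p‖ ≤ r p) :
    1 ≤ ∑' p, ENNReal.ofReal (2 * r p) * ENNReal.ofReal (2 * ρ p) ^ d := by
  set m : Measure (Torus (d + 1)) := volume.withDensity fun q => ‖γ q‖ₑ with hm
  have hmfin : IsFiniteMeasure m :=
    isFiniteMeasure_withDensity (hu.lintegral_ne_top (Nat.succ_pos d))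
  have hsum : ∑' p, m (D p) ≠ ⊤ := by
    refine ne_top_of_le_ne_top (measure_ne_top m univ) ?_
    exact tsum_measure_le_measure_univ (fun p => (hDm p).nullMeasurableSet)
      (fun p q h => (hdisj h).aedisjoint)
  have htail := ENNReal.tendsto_tsum_compl_atTop_zero hsum
  have hP : ∀ P : Finset ι, 1 ≤ (∑' p, ENNReal.ofReal (2 * r p) * ENNReal.ofReal (2 * ρ p) ^ d) +
      ∑' p : {p // p ∉ P}, m (D p) := by
    intro P
    set N : Set (Torus (d + 1)) := (⋃ p ∈ P, D p)ᶜ with hN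
    have hNm : MeasurableSet N := (Finset.measurableSet_biUnion P fun p _ => hDm p).compl
    have hcover : ∀ q, q ∈ N ∨ ∃ p ∈ P, q ∈ D p := by
      intro q
      by_cases hq : ∃ p ∈ P, q ∈ D p
      · exact Or.inr hq
      · exact Or.inl fun h => hq (by simpa using h)
    refine (hu.one_le_sum_add P D c ρ (fun p _ => hD p) c' r hr0 (fun p _ => hr p) hNm hcover).trans
      (add_le_add (ENNReal.sum_le_tsum P) ?_)
    rw [← withDensity_apply _ hNm]
    have hsub : N ⊆ (⋃ p : {p // p ∉ P}, D p) ∪ (⋃ p, D p)ᶜ := by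
      intro q hq
      by_cases h : q ∈ ⋃ p, D p
      · obtain ⟨p, hp⟩ := mem_iUnion.1 h
        exact Or.inl (mem_iUnion.2 ⟨⟨p, fun hpP => hq (mem_iUnion₂.2 ⟨p, hpP, hp⟩)⟩, hp⟩)
      · exact Or.inr h
    have h0 : m (⋃ p, D p)ᶜ = 0 := withDensity_absolutelyContinuous _ _ hnull
    calc m N ≤ m (⋃ p : {p // p ∉ P}, D p) + m (⋃ p, D p)ᶜ :=
          (measure_mono hsub).trans (measure_union_le _ _)
      _ ≤ ∑' p : {p // p ∉ P}, m (D p) := by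
          rw [h0, add_zero]
          exact measure_iUnion_le _
  have hlim := (tendsto_const_nhds (x := ∑' p, ENNReal.ofReal (2 * r p) *
    ENNReal.ofReal (2 * ρ p) ^ d)).add htail
  rw [add_zero] at hlim
  exact ge_of_tendsto' hlim hP

/-- Correlations of a weight in `ℓᵈ⁺¹` with its translates along an infinite orbit tend to zero. -/
lemma exists_tsum_mul_pow_lt_one {Γ : Type*} [AddCommGroup Γ] {a : Γ}
    (ha : Function.Injective fun k : ℕ => k • a) {b : Γ → ENNReal} {d : ℕ} (hd : 1 ≤ d)
    (hb : ∑' p, b p ^ (d + 1) ≠ ⊤) : ∃ k : ℕ, ∑' p, b (p + k • a) * b p ^ d < 1 := by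
  classical
  set S := ∑' p, b p ^ (d + 1) with hS
  have hbt : ∀ p, b p ≠ ⊤ := fun p hp => by
    have := ENNReal.ne_top_of_tsum_ne_top hb p
    rw [hp] at this
    simp at this
  have h4 : (1 / 4 : ENNReal) ≠ 0 := by simp
  obtain ⟨δ, hδ0, hδ⟩ := ENNReal.exists_nnreal_pos_mul_lt hb h4
  have hδ0' : (δ : ENNReal) ≠ 0 := by exact_mod_cast hδ0.ne'
  set T : ENNReal := (δ : ENNReal)⁻¹ ^ d with hT
  have hTt : T ≠ ⊤ := ENNReal.pow_ne_top (ENNReal.inv_ne_top.2 hδ0')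
  -- a finite set outside which the weight is small
  have htail := ENNReal.tendsto_tsum_compl_atTop_zero hb
  have htail' := ENNReal.Tendsto.const_mul (a := T) htail (Or.inr hTt)
  rw [mul_zero] at htail'
  obtain ⟨P, hP⟩ := (htail'.eventually (gt_mem_nhds (pos_iff_ne_zero.2 h4))).exists
  -- the translates of the finite set run off to infinity
  have hfin : Tendsto (fun k : ℕ => ∑ q ∈ P, b q * b (q - k • a) ^ d) atTop (𝓝 0) := by
    rw [← Finset.sum_const_zero (s := P)]
    refine tendsto_finsetSum _ fun q _ => ?_
    have hinj : Function.Injective fun k : ℕ => q - k • a := fun k l h => ha (sub_right_injective h)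
    have h1 : ∑' k : ℕ, b (q - k • a) ^ (d + 1) ≠ ⊤ :=
      ne_top_of_le_ne_top hb (ENNReal.tsum_comp_le_tsum_of_injective hinj fun p => b p ^ (d + 1))
    have h2 := ENNReal.tendsto_atTop_zero_of_tsum_ne_top h1
    have h3 : Tendsto (fun k : ℕ => b (q - k • a) ^ d) atTop (𝓝 0) := by
      have h5 := h2.ennrpow_const ((d : ℝ) / (d + 1))
      rw [ENNReal.zero_rpow_of_pos (by positivity)] at h5
      refine h5.congr fun k => ?_
      rw [← ENNReal.rpow_natCast, ← ENNReal.rpow_mul, ← ENNReal.rpow_natCast]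
      congr 1
      push_cast
      field_simp
    simpa using ENNReal.Tendsto.const_mul (a := b q) h3 (Or.inr (hbt q))
  obtain ⟨k, hk⟩ := (hfin.eventually (gt_mem_nhds (pos_iff_ne_zero.2 h4))).exists
  refine ⟨k, ?_⟩
  set b₀ : Γ → ENNReal := fun q => if q ∈ P then b q else 0 with hb₀
  set b₁ : Γ → ENNReal := fun q => if q ∈ P then 0 else b q with hb₁
  have hbb : ∀ q, b q = b₀ q + b₁ q := fun q => by
    by_cases hq : q ∈ P <;> simp [hb₀, hb₁, hq]
  have e0 : ∑' p, b₀ (p + k • a) * b p ^ d = ∑ q ∈ P, b q * b (q - k • a) ^ d := by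
    rw [← (Equiv.subRight (k • a)).tsum_eq fun p => b₀ (p + k • a) * b p ^ d]
    rw [tsum_eq_sum (s := P)]
    · refine Finset.sum_congr rfl fun q hq => ?_
      simp [hb₀, hq]
    · intro q hq
      simp [hb₀, hq]
  have e1 : ∑' p, b₁ (p + k • a) * b p ^ d ≤ δ * S + T * ∑' q : {q // q ∉ P}, b q ^ (d + 1) := by
    have h1 : ∑' p, b₁ (p + k • a) ^ (d + 1) = ∑' q : {q // q ∉ P}, b q ^ (d + 1) := by
      refine ((Equiv.addRight (k • a)).tsum_eq fun p => b₁ p ^ (d + 1)).trans ?_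
      have h2 : (fun p => b₁ p ^ (d + 1)) =
          ({q | q ∉ P} : Set Γ).indicator fun q => b q ^ (d + 1) := by
        funext q
        by_cases hq : q ∈ P <;> simp [hb₁, hq]
      rw [h2]
      exact (tsum_subtype ({q | q ∉ P} : Set Γ) fun q => b q ^ (d + 1)).symm
    rw [← h1, ← ENNReal.tsum_mul_left, ← ENNReal.tsum_mul_left, ← ENNReal.tsum_add]
    exact ENNReal.tsum_le_tsum fun p => mul_pow_le_add hδ0' ENNReal.coe_ne_top d
  calc ∑' p, b (p + k • a) * b p ^ d
      = ∑' p, b₀ (p + k • a) * b p ^ d + ∑' p, b₁ (p + k • a) * b p ^ d := by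
        rw [← ENNReal.tsum_add]
        refine tsum_congr fun p => ?_
        rw [hbb (p + k • a), add_mul]
    _ ≤ 1 / 4 + (1 / 4 + 1 / 4) := by
        rw [e0]
        exact add_le_add hk.le (e1.trans (add_le_add hδ.le hP.le))
    _ < 1 := by
        have : (1 / 4 + (1 / 4 + 1 / 4) : ENNReal) = ENNReal.ofReal (3 / 4) := by
          rw [show (1 / 4 : ENNReal) = ENNReal.ofReal (1 / 4) by
            rw [ENNReal.ofReal_div_of_pos (by norm_num)]; simp,
            ← ENNReal.ofReal_add (by norm_num) (by norm_num),
            ← ENNReal.ofReal_add (by norm_num) (by norm_num)]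
          norm_num
        rw [this, ← ENNReal.ofReal_one]
        exact (ENNReal.ofReal_lt_ofReal_iff one_pos).2 (by norm_num)

/-! ### Wandering domains and quasiconformal lifts -/

lemma flatDist_le {n : ℕ} (p q : Torus n) : flatDist p q ≤ n + 1 := by
  refine Real.sqrt_le_iff.2 ⟨by positivity, ?_⟩
  calc ∑ i, ‖p i - q i‖ ^ 2 ≤ ∑ _i : Fin n, (1 : ℝ) := by
        refine Finset.sum_le_sum fun i _ => ?_
        have h := AddCircle.norm_le_half_period (1 : ℝ) (x := p i - q i) one_ne_zero
        rw [abs_one] at h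
        have h0 := norm_nonneg (p i - q i)
        nlinarith
    _ = n := by simp
    _ ≤ (n + 1 : ℝ) ^ 2 := by nlinarith [(Nat.cast_nonneg n : (0 : ℝ) ≤ n)]

/-- A flat ball contains a box, the product of balls of the circle factors. -/
lemma pow_le_volume_flatBall {n : ℕ} (c : Torus n) {r : ℝ} (hr : 0 < r) :
    ENNReal.ofReal (min 1 (2 * (r / (n + 1)))) ^ n ≤ volume (flatBall c r) := by
  have hsub : (univ.pi fun i => Metric.closedBall (c i) (r / (n + 1))) ⊆ flatBall c r := by
    intro q hq
    have hq' : ∀ i, ‖q i - c i‖ ≤ r / (n + 1) := fun i => by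
      simpa [dist_eq_norm] using hq i (mem_univ i)
    refine (Real.sqrt_lt' hr).2 ?_
    calc ∑ i, ‖q i - c i‖ ^ 2 ≤ ∑ _i : Fin n, (r / (n + 1)) ^ 2 :=
          Finset.sum_le_sum fun i _ => pow_le_pow_left₀ (norm_nonneg _) (hq' i) 2
      _ = n * (r / (n + 1)) ^ 2 := by simp
      _ < r ^ 2 := by
          have hn : (0 : ℝ) ≤ n := Nat.cast_nonneg n
          rw [div_pow, mul_div_assoc', div_lt_iff₀ (by positivity)]
          have hr2 := pow_pos hr 2
          nlinarith [mul_nonneg hn hr2.le, mul_nonneg (mul_nonneg hn hn) hr2.le]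
  refine le_trans (le_of_eq ?_) (measure_mono hsub)
  rw [volume_pi_pi]
  simp [AddCircle.volume_closedBall]

/-- In a set of bounded geometry, the `n`-th power of an outer radius is controlled by the
volume. -/
lemma exists_radius_of_flatBall {n : ℕ} {D : Set (Torus n)} {c : Torus n} {r R C : ℝ} (hr : 0 < r)
    (hC : 1 ≤ C) (h1 : flatBall c r ⊆ D) (h2 : D ⊆ flatBall c R) (hRr : R / r ≤ C)
    (hR : 0 ≤ R) :
    ∃ ρ : ℝ, 0 ≤ ρ ∧ (∀ q ∈ D, flatDist q c ≤ ρ) ∧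
      ENNReal.ofReal (2 * ρ) ^ n ≤ ENNReal.ofReal (2 * C * (n + 1)) ^ n * volume D := by
  have hn : (0 : ℝ) ≤ n := Nat.cast_nonneg n
  -- the diameter bound is needed when `r` exceeds the size of the torus, whose balls have volume
  -- at most one
  refine ⟨min R (n + 1), le_min hR (by positivity),
    fun q hq => le_min (h2 hq : flatDist q c < R).le (flatDist_le q c), ?_⟩
  refine le_trans ?_ (mul_le_mul_right ((pow_le_volume_flatBall c hr).trans (measure_mono h1)) _)
  rw [← mul_pow, ← ENNReal.ofReal_mul (by positivity)]
  refine pow_le_pow_left' (ENNReal.ofReal_le_ofReal ?_) n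
  have hRC : R ≤ C * r := (div_le_iff₀ hr).1 hRr
  rcases le_total 1 (2 * (r / (n + 1))) with h | h
  · rw [min_eq_left h]
    have : min R (n + 1 : ℝ) ≤ n + 1 := min_le_right _ _
    nlinarith
  · rw [min_eq_right h]
    have e : 2 * C * (n + 1) * (2 * (r / (n + 1))) = 4 * (C * r) := by field_simp; ring
    rw [e]
    have : min R (n + 1 : ℝ) ≤ R := min_le_left _ _
    nlinarith

lemma infinite_unitAddCircle : Infinite UnitAddCircle := by
  have : Infinite (Ico (0 : ℝ) (0 + 1)) := (Ico_infinite (by norm_num)).to_subtype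
  exact Infinite.of_injective _ (AddCircle.equivIco (1 : ℝ) 0).symm.injective

/-- The powers of a minimal translation of a torus of positive dimension are distinct. -/
lemma IsMinimalTranslation.injective_nsmul {n : ℕ} (hn : 1 ≤ n) {a : Torus n}
    (ha : IsMinimalTranslation a) : Function.Injective fun k : ℕ => k • a := by
  rw [injective_nsmul_iff_not_isOfFinAddOrder]
  intro hfin
  have hfinite : (range fun k : ℤ => (0 : Torus n) + k • a).Finite := by
    have h := finite_zmultiples.2 hfin
    convert h using 1
    ext x
    simp [AddSubgroup.mem_zmultiples_iff]
  have huniv := (ha 0).closure_eq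
  rw [hfinite.isClosed.closure_eq] at huniv
  rw [huniv] at hfinite
  have := infinite_unitAddCircle
  have : Nonempty (Fin n) := ⟨⟨0, hn⟩⟩
  exact infinite_univ hfinite

/-- A non-empty open set of a torus of positive dimension has more than one point. -/
lemma nontrivial_of_isOpen {n : ℕ} (hn : 1 ≤ n) {D : Set (Torus n)} (hD : IsOpen D)
    (hne : D.Nonempty) : D.Nontrivial := by
  have : Nonempty (Fin n) := ⟨⟨0, hn⟩⟩
  have hnt : Nontrivial (Torus n) := by
    have := infinite_unitAddCircle
    infer_instance
  rw [← not_subsingleton_iff]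
  intro hs
  obtain ⟨x, hx⟩ := hne
  have : D = {x} := hs.eq_singleton_of_mem hx
  rw [this, isOpen_singleton_iff_punctured_nhds] at hD
  exact NeBot.ne inferInstance hD

/-- The interiors of the fibres of `h` are permuted by `f` as their values are by the
translation. -/
lemma iterate_mem_interior_fiber {n : ℕ} {f : Torus n ≃ₜ Torus n} {h : C(Torus n, Torus n)}
    {a : Torus n} (hfa : ∀ x, h (f x) = h x + a) {p x : Torus n} (hx : x ∈ interior (h ⁻¹' {p}))
    (k : ℕ) : f^[k] x ∈ interior (h ⁻¹' {p + k • a}) := by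
  induction k with
  | zero => simpa using hx
  | succ k ih =>
    rw [Function.iterate_succ_apply']
    have hsub : f '' interior (h ⁻¹' {p + k • a}) ⊆ h ⁻¹' {p + (k + 1) • a} := by
      rintro _ ⟨y, hy, rfl⟩
      have hy1 : y ∈ h ⁻¹' {p + k • a} := interior_subset hy
      have hy' : h y = p + k • a := hy1
      simp only [mem_preimage, mem_singleton_iff, hfa, hy', succ_nsmul]
      abel
    exact interior_maximal hsub (f.isOpenMap _ isOpen_interior) (mem_image_of_mem _ ih)

lemma LocallyLn.aestronglyMeasurable {n : ℕ} {G : Euc n → Euc n →L[ℝ] Euc n} (hG : LocallyLn G) :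
    AEStronglyMeasurable G volume := by
  have h := (aestronglyMeasurable_iUnion_iff (μ := volume) (f := G)
    (s := fun j : ℕ => Metric.closedBall (0 : Euc n) j)).2
      fun j => (hG _ (isCompact_closedBall _ _)).1
  rwa [Metric.iUnion_closedBall_nat, Measure.restrict_univ] at h

/-- The lift of a quasiconformal homeomorphism, with a Borel representative of its differential and
with the distortion inequality stated for the operator norm. -/
lemma IsQuasiconformal.exists_lift {n : ℕ} (hn : 1 ≤ n) {f : Torus n ≃ₜ Torus n}
    (hf : IsQuasiconformal f) :
    ∃ F : Euc n → Euc n, Continuous F ∧ (∀ x, proj n (F x) = f (proj n x)) ∧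
      ∃ G : Euc n → Euc n →L[ℝ] Euc n, Measurable G ∧ HasWeakDifferential F G ∧ LocallyLn G ∧
        (∀ᵐ x, 0 ≤ (G x).det) ∧
          ∃ K : NNReal, ∀ᵐ x, ‖G x‖ₑ ^ n ≤ K * ENNReal.ofReal (G x).det := by
  obtain ⟨F, hF, hFf, G, hw, hL, K, hK, hKG⟩ := hf
  have hG := hL.aestronglyMeasurable
  have hn0 : n ≠ 0 := by omega
  have hae : G =ᵐ[volume] hG.mk G := hG.ae_eq_mk
  refine ⟨F, hF, hFf, hG.mk G, hG.stronglyMeasurable_mk.measurable, ?_, ?_, ?_, ⟨K, hK.le⟩, ?_⟩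
  · intro φ hφ hφs v
    rw [hw φ hφ hφs v]
    congr 1
    refine integral_congr_ae ?_
    filter_upwards [hae] with x hx
    rw [hx]
  · exact fun A hA => (memLp_congr_ae (ae_restrict_of_ae hae)).1 (hL A hA)
  · filter_upwards [hae, hKG] with x hx hxK
    have h0 := hxK 0 (by simp)
    simp only [map_zero, norm_zero, zero_pow hn0] at h0
    rw [← hx]
    exact nonneg_of_mul_nonneg_right h0 hK
  · filter_upwards [hae, hKG] with x hx hxK
    rw [← hx]
    have h0 := hxK 0 (by simp)
    simp only [map_zero, norm_zero, zero_pow hn0] at h0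
    set t : ℝ := (K * (G x).det) ^ ((n : ℝ)⁻¹) with ht
    have ht0 : 0 ≤ t := Real.rpow_nonneg h0 _
    have htn : t ^ n = K * (G x).det := Real.rpow_inv_natCast_pow h0 hn0
    have hle : ‖G x‖ ≤ t := by
      refine ContinuousLinearMap.opNorm_le_of_unit_norm ht0 fun v hv => ?_
      refine le_of_pow_le_pow_left₀ hn0 ht0 ?_
      rw [htn]
      exact hxK v hv.le
    have h1 : ‖G x‖ ^ n ≤ K * (G x).det := htn ▸ pow_le_pow_left₀ (norm_nonneg _) hle n
    have h2 := ENNReal.ofReal_le_ofReal h1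
    rw [ENNReal.ofReal_pow (norm_nonneg _), ofReal_norm, ENNReal.ofReal_mul hK.le] at h2
    rw [ENNReal.ofReal_eq_coe_nnreal hK.le] at h2
    exact h2

end DenjoyTori

end

/-! ### Crossing inequality against decorrelation -/

theorem theoremT (n : ℕ) (hn : 2 ≤ n) :
    ¬ ∃ (f : DenjoyTori.Torus n ≃ₜ DenjoyTori.Torus n)
        (h : C(DenjoyTori.Torus n, DenjoyTori.Torus n)),
      DenjoyTori.IsDenjoyType f h ∧
      DenjoyTori.IsQuasiconformal f ∧
      MeasureTheory.volume (DenjoyTori.minimalSet h) = 0 ∧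
      DenjoyTori.HasBoundedGeometry (DenjoyTori.wanderingDomains h) := by
  open DenjoyTori in
  rintro ⟨f, h, hden, hqc, hnull, C, hC, hgeom⟩
  obtain ⟨d, rfl⟩ : ∃ d, n = d + 1 := ⟨n - 1, by omega⟩
  have hn1 : 1 ≤ d + 1 := by omega
  obtain ⟨a, ha, hfa⟩ := hden.semiconj
  obtain ⟨F, hF, hFf, G, hGm, hw, hL, hdet, K, hK⟩ := hqc.exists_lift hn1
  have hFe : IsEquivariant F := by
    have hhom : (ContinuousMap.id (Torus (d + 1))).Homotopic
        (f : C(Torus (d + 1), Torus (d + 1))) := by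
      obtain ⟨H⟩ := hden.isotopic
      exact ⟨H.toHomotopy⟩
    exact isEquivariant_of_lift hhom hF hFf
  -- the lifts of the iterates of `f`
  have hlift : ∀ (k : ℕ) x, proj (d + 1) (F^[k] x) = f^[k] (proj (d + 1) x) := by
    intro k
    induction k with
    | zero => intro x; rfl
    | succ k ih => intro x; rw [Function.iterate_succ_apply, Function.iterate_succ_apply, ih, hFf]
  -- their first coordinates are Sobolev limits
  have hSob : ∀ k : ℕ, ∃ γ, IsSobolevLimit (0 : Fin (d + 1)) (fun x => F^[k] x 0) γ := by
    intro k
    induction k with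
    | zero => exact ⟨_, isSobolevLimit_coordinate 0⟩
    | succ k ih =>
      obtain ⟨γ, hγ⟩ := ih
      exact ⟨_, hγ.comp hn1 f.continuous.measurable hFf hF hFe hGm hw hL hdet hK⟩
  -- the domains and their radii
  set D : Torus (d + 1) → Set (Torus (d + 1)) := fun p => interior (h ⁻¹' {p}) with hDdef
  have hDV : ∀ p, (D p).Nonempty → p ∈ nontrivialValues h := fun p hp =>
    (nontrivial_of_isOpen hn1 isOpen_interior hp).mono interior_subset
  have hrad : ∀ p, ∃ (c : Torus (d + 1)) (ρ : ℝ), 0 ≤ ρ ∧ (∀ q ∈ D p, flatDist q c ≤ ρ) ∧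
      ENNReal.ofReal (2 * ρ) ^ (d + 1) ≤
        ENNReal.ofReal (2 * C * ((d + 1 : ℕ) + 1)) ^ (d + 1) * MeasureTheory.volume (D p) := by
    intro p
    rcases Set.eq_empty_or_nonempty (D p) with hp | hp
    -- an empty domain gets radius zero, so that it does not contribute to the sums below
    · exact ⟨0, 0, le_rfl, by simp [hp], by simp⟩
    · obtain ⟨c, -, r, R, hr, hrR, h1, h2, h3⟩ := hgeom (D p) ⟨hp, p, hDV p hp, rfl⟩
      exact ⟨c, exists_radius_of_flatBall hr hC h1 h2 h3 (hr.le.trans hrR)⟩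
  choose c ρ hρ0 hρ hvol using hrad
  have hdisj : Pairwise (Function.onFun Disjoint D) := fun p q hpq =>
    (Set.disjoint_singleton.2 hpq).preimage h |>.mono interior_subset interior_subset
  have hDm : ∀ p, MeasurableSet (D p) := fun p => isOpen_interior.measurableSet
  -- disjointness of the domains bounds the sum of their volumes
  have hsum : ∑' p, ENNReal.ofReal (2 * ρ p) ^ (d + 1) ≠ ⊤ := by
    refine ne_top_of_le_ne_top ?_ (ENNReal.tsum_le_tsum hvol)
    rw [ENNReal.tsum_mul_left]
    refine ENNReal.mul_ne_top (ENNReal.pow_ne_top ENNReal.ofReal_ne_top) ?_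
    refine ne_top_of_le_ne_top (MeasureTheory.measure_ne_top
      (MeasureTheory.volume : MeasureTheory.Measure (Torus (d + 1))) Set.univ) ?_
    exact MeasureTheory.tsum_measure_le_measure_univ (fun p => (hDm p).nullMeasurableSet)
      (fun p q hpq => (hdisj hpq).aedisjoint)
  -- an iterate for which the crossing inequality must fail; here `d = n - 1 ≥ 1` is used
  obtain ⟨k, hk⟩ := exists_tsum_mul_pow_lt_one (ha.injective_nsmul hn1) (by omega : 1 ≤ d) hsum
  obtain ⟨γ, hγ⟩ := hSob k
  have hcount : Countable {p // (D p).Nonempty} := (hden.countable.mono hDV).to_subtype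
  -- the domains fill the torus up to the minimal set, which is null
  have hcov : MeasureTheory.volume (⋃ p : {p // (D p).Nonempty}, D p)ᶜ = 0 := by
    refine MeasureTheory.measure_mono_null (Set.compl_subset_compl.2 ?_) hnull
    intro q hq
    obtain ⟨p, -, hqp⟩ := Set.mem_iUnion₂.1 hq
    exact Set.mem_iUnion.2 ⟨⟨p, q, hqp⟩, hqp⟩
  have hone := hγ.one_le_tsum (ι := {p // (D p).Nonempty}) (fun p => D p) (fun p => hDm p)
    (fun p q hpq => hdisj (Subtype.coe_ne_coe.2 hpq)) hcov (fun p => c p) (fun p => ρ p)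
    (fun p => hρ p) (fun p => c (p + k • a) 0) (fun p => ρ (p + k • a)) (fun p => hρ0 _) ?_
  -- `fᵏ` maps `D p` into `D (p + k • a)`, so the first coordinate of its lift maps `D p` into an
  -- arc of radius `ρ (p + k • a)`
  · refine absurd hk (not_lt.2 (hone.trans ?_))
    exact ENNReal.tsum_comp_le_tsum_of_injective Subtype.val_injective
      fun p => ENNReal.ofReal (2 * ρ (p + k • a)) * ENNReal.ofReal (2 * ρ p) ^ d
  · intro p x hx
    have hmem : proj (d + 1) (F^[k] x) ∈ D (p + k • a) := by
      rw [hlift]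
      exact iterate_mem_interior_fiber hfa hx k
    exact (norm_sub_le_flatDist (proj (d + 1) (F^[k] x)) (c (p + k • a)) 0).trans (hρ _ _ hmem)
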